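/- Let $d\in\mathbb N$, $m\in\mathbb R^d$ and let $C\in\mathbb R^{d\times d}$ be symmetric positive semidefinite. For every $J\in\mathbb N$ let $X_1,\dots,X_J$ be i.i.d. random vectors with law $\mathcal N(m,C)$ (for different $J$ they may live on different probability spaces), and put $$\tilde m^{(J)}=\frac1J\sum_{i=1}^J X_i,\qquad \tilde C^{(J)}=\frac1{J-1}\sum_{i=1}^J (X_i-\tilde m^{(J)})(X_i-\tilde m^{(J)})^\top .$$ For probability measures $\mu,\nu$ on $\mathbb R^d$ let $D_{\mathrm{KL}}(\mu\,\|\,\nu)=\int\log\frac{d\mu}{d\nu}\,d\mu\in[0,\infty]$ if $\mu\ll\nu$, and $D_{\mathrm{KL}}(\mu\,\|\,\nu)=\infty$ otherwise. Let $Z_J$ be either of the $[0,\infty]$-valued random variables $$D_{\mathrm{KL}}\bigl(\mathcal N(m,C)\,\big\|\,\mathcal N(\tilde m^{(J)},\tilde C^{(J)})\bigr),\qquad D_{\mathrm{KL}}\bigl(\mathcal N(\tilde m^{(J)},\tilde C^{(J)})\,\big\|\,\mathcal N(m,C)\bigr).$$ Then $Z_J$ converges to $0$ in $L^2$ as $J\to\infty$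 with rate $O(J^{-1})$: for all sufficiently large $J$ the variable $Z_J$ is (almost everywhere) measurable with $\mathbb E[Z_J^2]<\infty$, $\mathbb E[Z_J^2]^{1/2}\to0$, and $\mathbb E[Z_J^2]^{1/2}=O(J^{-1})$. -/

import Mathlib

open MeasureTheory ProbabilityTheory InformationTheory Filter Asymptotics
open scoped ENNReal Topology

noncomputable section

/-- The sample mean `J⁻¹ ∑ᵢ xᵢ` of `J` vectors in `ℝ^d`. -/
def sampleMean {d J : ℕ} (x : Fin J → EuclideanSpace ℝ (Fin d)) : EuclideanSpace ℝ (Fin d) :=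
  (J : ℝ)⁻¹ • ∑ i, x i

/-- The unbiased sample covariance matrix `(J - 1)⁻¹ ∑ᵢ (xᵢ - x̄)(xᵢ - x̄)ᵀ` of `J` vectors
in `ℝ^d`, where `x̄` is their sample mean. -/
def sampleCov {d J : ℕ} (x : Fin J → EuclideanSpace ℝ (Fin d)) : Matrix (Fin d) (Fin d) ℝ :=
  ((J : ℝ) - 1)⁻¹ •
    ∑ i, Matrix.vecMulVec (x i - sampleMean x).ofLp (x i - sampleMean x).ofLp

/-- The `[0, ∞]`-valued random variables `f J`, each on its own probability space
`(Ω J, P J)`, converge to `0` in `L²` with rate `O(r J)` as `J → ∞`: from some `J` on they are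
measurable with finite second moment, and their `L²` norms tend to `0` and are `O(r J)`.
The values are in `[0, ∞]`, so that finiteness almost surely is part of the claim. -/
def ConvergesToZeroInL2WithRate {Ω : ℕ → Type*} [∀ J, MeasurableSpace (Ω J)]
    (P : ∀ J, Measure (Ω J)) (f : ∀ J, Ω J → ℝ≥0∞) (r : ℕ → ℝ) : Prop :=
  (∀ᶠ J in atTop, MemLp (f J) 2 (P J)) ∧
  Tendsto (fun J => eLpNorm (f J) 2 (P J)) atTop (𝓝 0) ∧
  (fun J => (eLpNorm (f J) 2 (P J)).toReal) =O[atTop] r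

end

/-! An injective affine map has a measurable left inverse and therefore preserves the divergence.
Writing `C = A Aᵀ` with `A` injective turns the claim, also for singular `C`, into the same claim
for standard Gaussian samples in dimension `r = rank C`, because sample mean and sample covariance
transform along with the sample.

For standard samples of large size the sample covariance `S` is almost surely positive definite, and
both divergences have closed forms in `S` and the sample mean `a`. The inequality `log det S ≤ tr S
- r`, applied to `S` or to `S⁻¹`, bounds both by `(1 + c⁻¹) g`, where `c > 0` is a lower bound for
the spectrum of `S` and `g = ‖S - 1‖² + ‖a‖²` (Frobenius norm). Since `g` is quadratic in the
errors, `J g` is a polynomial in normalized sums of centred variables with an exponential moment.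
Its moments are bounded uniformly in `J` (`hasBoundedMoments_scaledDeviation`), which gives the rate
`J⁻¹`.

It remains to bound the mean of `c⁻⁴` for large `J` (`lintegral_sum_gramBound_rpow_neg_le`). Cut the
sample into `K` disjoint blocks of `2r` vectors, with `K` proportional to `J`. The `r` differences
inside block `k` form a matrix `Gₖ`, and `(J - 1) S` dominates `∑ qₖ`, where `qₖ` bounds the
spectrum of `Gₖᵀ Gₖ / 2` from below. By AM-GM and independence, `E (∑ qₖ)⁻⁴ ≤ K⁻⁴ (E q^(-4/K))^K`. A
single `q` is only shown to have a small negative moment, but for `K ≥ 32` monotonicity of `L^p`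
norms gives `(E q^(-4/K))^K ≤ (E q^(-1/8))^32`, uniformly in `K`. The moment `E q^(-1/8)` is finite
because `E |det (Z + M)|^(-1/2)` is bounded uniformly in `M` for a Gaussian matrix `Z`
(`lintegral_invSqrtAbs_det_le`). Given the other rows, the determinant is affine in one Gaussian
row, and the Gaussian density is bounded. -/

/-! ### Divergence under injective maps, and the standard Gaussian against its affine images. -/

/-- Data processing inequality, used once for `g` and once for `h`. -/
lemma klDiv_map_of_leftInverse {α β : Type*} [MeasurableSpace α] [MeasurableSpace β]
    (μ ν : Measure α) [IsFiniteMeasure μ] [IsFiniteMeasure ν] {g : α → β} {h : β → α}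
    (hg : Measurable g) (hh : Measurable h) (hinv : Function.LeftInverse h g) :
    klDiv (μ.map g) (ν.map g) = klDiv μ ν := by
  refine le_antisymm (klDiv_map_le μ ν hg) ?_
  have key := klDiv_map_le (μ.map g) (ν.map g) hh
  rwa [Measure.map_map hh hg, Measure.map_map hh hg, hinv.comp_eq_id, Measure.map_id,
    Measure.map_id] at key

/-- The standard Gaussian measure on `ι → ℝ`. -/
noncomputable abbrev stdGaussianPi (ι : Type*) [Fintype ι] : Measure (ι → ℝ) :=
  Measure.pi fun _ => gaussianReal 0 1

/-- The density of the standard Gaussian measure on `ι → ℝ`. -/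
noncomputable def stdGaussianPiPDF {ι : Type*} [Fintype ι] (x : ι → ℝ) : ℝ :=
  ∏ i, gaussianPDFReal 0 1 (x i)

section density

variable {ι : Type*} [Fintype ι]

lemma stdGaussianPiPDF_pos (x : ι → ℝ) : 0 < stdGaussianPiPDF x :=
  Finset.prod_pos fun _ _ => gaussianPDFReal_pos _ _ _ one_ne_zero

@[fun_prop]
lemma measurable_stdGaussianPiPDF : Measurable (stdGaussianPiPDF (ι := ι)) :=
  Finset.measurable_prod _ fun i _ =>
    (measurable_gaussianPDFReal 0 1).comp (measurable_pi_apply i)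

lemma log_stdGaussianPiPDF (x : ι → ℝ) :
    Real.log (stdGaussianPiPDF x) =
      Fintype.card ι * Real.log (√(2 * Real.pi))⁻¹ - (∑ i, x i ^ 2) / 2 := by
  have h0 : (√(2 * Real.pi))⁻¹ ≠ 0 := by positivity
  rw [stdGaussianPiPDF, Real.log_prod fun i _ => (gaussianPDFReal_pos _ _ _ one_ne_zero).ne']
  simp only [gaussianPDFReal, NNReal.coe_one, mul_one, sub_zero]
  simp_rw [Real.log_mul h0 (Real.exp_ne_zero _), Real.log_exp]
  rw [Finset.sum_add_distrib, Finset.sum_const, Finset.card_univ, nsmul_eq_mul,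
    ← Finset.sum_div, Finset.sum_neg_distrib]
  ring

lemma stdGaussianPi_eq_withDensity :
    stdGaussianPi ι = volume.withDensity fun x => ENNReal.ofReal (stdGaussianPiPDF x) := by
  refine Measure.pi_eq fun s hs => ?_
  rw [withDensity_apply _ (.univ_pi hs), volume_pi, Measure.restrict_pi_pi]
  have hint : ∀ i, Integrable (gaussianPDFReal 0 1) (volume.restrict (s i)) := fun i =>
    (integrable_gaussianPDFReal 0 1).restrict
  rw [← ofReal_integral_eq_lintegral_ofReal]
  · simp only [stdGaussianPiPDF]
    rw [integral_fintype_prod_eq_prod (fun _ => gaussianPDFReal 0 1),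
      ENNReal.ofReal_prod_of_nonneg fun i _ =>
        integral_nonneg fun _ => gaussianPDFReal_nonneg _ _ _]
    refine Finset.prod_congr rfl fun i _ => ?_
    rw [gaussianReal_apply_eq_integral _ one_ne_zero]
  · exact Integrable.fintype_prod hint
  · exact ae_of_all _ fun x => (stdGaussianPiPDF_pos x).le

variable [DecidableEq ι]

/-- Change of variables. The inverse `N` is a parameter so that the density contains no matrix
inverse. -/
lemma map_affine_stdGaussianPi (a : ι → ℝ) {M N : Matrix ι ι ℝ} (hMN : M * N = 1) :
    (stdGaussianPi ι).map (fun x => a + M.mulVec x) =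
      volume.withDensity fun y =>
        ENNReal.ofReal (|N.det| * stdGaussianPiPDF (N.mulVec (y - a))) := by
  have hNM : N * M = 1 := mul_eq_one_comm.mp hMN
  have hdet : M.det * N.det = 1 := by rw [← Matrix.det_mul, hMN, Matrix.det_one]
  have hM : M.det ≠ 0 := left_ne_zero_of_mul_eq_one hdet
  have hinv : (M.det)⁻¹ = N.det := inv_eq_of_mul_eq_one_right hdet
  have hMmeas : Measurable fun x : ι → ℝ => M.mulVec x :=
    (Continuous.matrix_mulVec continuous_const continuous_id).measurable
  have hNmeas : Measurable fun x : ι → ℝ => N.mulVec (x - a) :=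
    (Continuous.matrix_mulVec continuous_const (continuous_id.sub continuous_const)).measurable
  have hT : Measurable fun x : ι → ℝ => a + M.mulVec x := hMmeas.const_add a
  have hvol : (volume : Measure (ι → ℝ)).map (fun x => a + M.mulVec x) =
      ENNReal.ofReal |N.det| • volume := by
    have hLmeas : Measurable (Matrix.toLin' M) := hMmeas
    have h1 := Real.map_matrix_volume_pi_eq_smul_volume_pi hM
    have h2 : (fun x : ι → ℝ => a + M.mulVec x) = (fun y => a + y) ∘ (Matrix.toLin' M) := by
      ext x; simp
    rw [h2, ← Measure.map_map (measurable_const_add a) hLmeas, h1,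
      Measure.map_smul, map_add_left_eq_self, hinv]
  ext s hs
  rw [Measure.map_apply hT hs, stdGaussianPi_eq_withDensity, withDensity_apply _ (hT hs),
    withDensity_apply _ hs]
  have h3 : ∀ x : ι → ℝ, stdGaussianPiPDF x =
      stdGaussianPiPDF (N.mulVec ((a + M.mulVec x) - a)) := fun x => by
    rw [add_sub_cancel_left, Matrix.mulVec_mulVec, hNM, Matrix.one_mulVec]
  rw [lintegral_congr fun x => by rw [h3 x]]
  rw [← setLIntegral_map (μ := volume)
    (f := fun y => ENNReal.ofReal (stdGaussianPiPDF (N.mulVec (y - a)))) hs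
    (by fun_prop) hT, hvol, Measure.restrict_smul, lintegral_smul_measure]
  simp_rw [ENNReal.ofReal_mul (abs_nonneg N.det)]
  rw [lintegral_const_mul _ (by fun_prop)]
  rfl

lemma klDiv_withDensity_ofReal {α : Type*} [MeasurableSpace α] {μ : Measure α} [SigmaFinite μ]
    {p q : α → ℝ} (hp : Measurable p) (hq : Measurable q) (hp0 : ∀ x, 0 < p x)
    (hq0 : ∀ x, 0 < q x)
    {γ ν : Measure α} [IsProbabilityMeasure γ] [IsProbabilityMeasure ν]
    (hγ : γ = μ.withDensity fun x => ENNReal.ofReal (p x))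
    (hν : ν = μ.withDensity fun x => ENNReal.ofReal (q x))
    (hint : Integrable (fun x => Real.log (p x) - Real.log (q x)) γ) :
    klDiv γ ν = ENNReal.ofReal (∫ x, (Real.log (p x) - Real.log (q x)) ∂γ) := by
  have h1 : γ = ν.withDensity fun x => ENNReal.ofReal (p x / q x) := by
    rw [hν, ← withDensity_mul _ (by fun_prop) (by fun_prop), hγ]
    congr 1
    ext x
    rw [Pi.mul_apply, ← ENNReal.ofReal_mul (hq0 x).le, mul_div_cancel₀ _ (hq0 x).ne']
  have hac : γ ≪ ν := h1 ▸ withDensity_absolutelyContinuous _ _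
  have hrn : γ.rnDeriv ν =ᵐ[γ] fun x => ENNReal.ofReal (p x / q x) := by
    refine hac.ae_le (?_ : γ.rnDeriv ν =ᵐ[ν] _)
    rw [h1]
    exact Measure.rnDeriv_withDensity _ (by fun_prop)
  have hllr : llr γ ν =ᵐ[γ] fun x => Real.log (p x) - Real.log (q x) := by
    filter_upwards [hrn] with x hx
    rw [llr, hx, ENNReal.toReal_ofReal (div_pos (hp0 x) (hq0 x)).le,
      Real.log_div (hp0 x).ne' (hq0 x).ne']
  -- The total mass terms in `klDiv` cancel for probability measures.
  rw [klDiv_of_ac_of_integrable hac ((integrable_congr hllr).mpr hint), integral_congr_ae hllr]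
  simp

omit [DecidableEq ι] in
lemma memLp_eval_stdGaussianPi (i : ι) (p : ℝ≥0∞) (hp : p ≠ ∞) :
    MemLp (fun x : ι → ℝ => x i) p (stdGaussianPi ι) :=
  (IsGaussian.memLp_id (gaussianReal 0 1) p hp).comp_measurePreserving
    (measurePreserving_eval (fun _ : ι => gaussianReal 0 1) i)

omit [DecidableEq ι] in
lemma memLp_affine_stdGaussianPi (c : ι → ℝ) (b : ℝ) :
    MemLp (fun x : ι → ℝ => ∑ j, c j * x j - b) 2 (stdGaussianPi ι) := by
  have h : MemLp (fun x : ι → ℝ => ∑ j, c j * x j) 2 (stdGaussianPi ι) :=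
    memLp_finsetSum _ fun j _ => (memLp_eval_stdGaussianPi j 2 (by simp)).const_mul _
  exact h.sub (memLp_const b)

omit [DecidableEq ι] in
lemma integral_sq_affine_stdGaussianPi (c : ι → ℝ) (b : ℝ) :
    ∫ x, (∑ j, c j * x j - b) ^ 2 ∂(stdGaussianPi ι) = ∑ j, c j ^ 2 + b ^ 2 := by
  have hm : ∀ j, MemLp (fun x : ι → ℝ => c j * x j) 2 (stdGaussianPi ι) := fun j =>
    (memLp_eval_stdGaussianPi j 2 (by simp)).const_mul _
  have hvar : Var[fun x : ι → ℝ => ∑ j, c j * x j; stdGaussianPi ι] = ∑ j, c j ^ 2 := by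
    have := variance_sum_pi (μ := fun _ : ι => gaussianReal 0 1) (X := fun j x => c j * x)
      (fun j => (IsGaussian.memLp_two_id).const_mul _)
    have h2 : (∑ j, fun x : ι → ℝ => c j * x j) = fun x => ∑ j, c j * x j := by
      ext x; simp
    rw [h2] at this
    rw [this]
    refine Finset.sum_congr rfl fun j _ => ?_
    rw [variance_const_mul]
    simp [show (fun x : ℝ => x) = id from rfl]
  have hmean : ∫ x, ∑ j, c j * x j ∂(stdGaussianPi ι) = 0 := by
    rw [integral_finsetSum _ fun j _ => (hm j).integrable (by norm_num)]
    refine Finset.sum_eq_zero fun j _ => ?_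
    rw [integral_const_mul, integral_eval]
    simp
  have hL : MemLp (fun x : ι → ℝ => ∑ j, c j * x j) 2 (stdGaussianPi ι) :=
    memLp_finsetSum _ fun j _ => hm j
  rw [variance_eq_sub hL, hmean] at hvar
  simp only [Pi.pow_apply] at hvar
  have hexp : ∀ x : ι → ℝ, (∑ j, c j * x j - b) ^ 2 =
      (∑ j, c j * x j) ^ 2 - (2 * b) * (∑ j, c j * x j) + b ^ 2 := fun x => by ring
  have hI : Integrable (fun x : ι → ℝ => (2 * b) * ∑ j, c j * x j) (stdGaussianPi ι) :=
    (hL.integrable (by norm_num)).const_mul _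
  have hI2 : Integrable (fun x : ι → ℝ => (∑ j, c j * x j) ^ 2 - (2 * b) * ∑ j, c j * x j)
      (stdGaussianPi ι) := hL.integrable_sq.sub hI
  simp_rw [hexp]
  rw [integral_add hI2 (integrable_const _), integral_sub hL.integrable_sq hI,
    integral_const_mul, hmean]
  simp
  linarith

/-- The Kullback-Leibler divergence of the standard Gaussian measure from its image under
an affine bijection. -/
theorem klDiv_stdGaussianPi_map_affine (a : ι → ℝ) {M N : Matrix ι ι ℝ} (hMN : M * N = 1) :
    klDiv (stdGaussianPi ι) ((stdGaussianPi ι).map fun x => a + M.mulVec x) =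
      ENNReal.ofReal ((∑ i, ∑ j, N i j ^ 2 + ∑ i, (N.mulVec a) i ^ 2 - Fintype.card ι) / 2
        - Real.log |N.det|) := by
  have hdet : M.det * N.det = 1 := by rw [← Matrix.det_mul, hMN, Matrix.det_one]
  have hN : 0 < |N.det| := abs_pos.mpr (right_ne_zero_of_mul_eq_one hdet)
  have hNmeas : Measurable fun x : ι → ℝ => N.mulVec (x - a) :=
    (Continuous.matrix_mulVec continuous_const (continuous_id.sub continuous_const)).measurable
  have hMmeas : Measurable fun x : ι → ℝ => a + M.mulVec x :=
    (Continuous.matrix_mulVec continuous_const continuous_id).measurable.const_add a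
  have : IsProbabilityMeasure ((stdGaussianPi ι).map fun x => a + M.mulVec x) :=
    Measure.isProbabilityMeasure_map hMmeas.aemeasurable
  -- The term `∑ xᵢ²` is written with the matrix `1` and the shift `0`, so that `hI` and `hE` below
  -- serve both quadratic terms.
  have hlog : ∀ x : ι → ℝ, Real.log (stdGaussianPiPDF x) -
      Real.log (|N.det| * stdGaussianPiPDF (N.mulVec (x - a))) =
      (∑ i, (∑ j, N i j * x j - N.mulVec a i) ^ 2
        - ∑ i, (∑ j, (1 : Matrix ι ι ℝ) i j * x j - (0 : ι → ℝ) i) ^ 2) / 2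
          - Real.log |N.det| := fun x => by
    rw [Real.log_mul hN.ne' (stdGaussianPiPDF_pos _).ne', log_stdGaussianPiPDF,
      log_stdGaussianPiPDF, Matrix.mulVec_sub]
    have : ∀ i, N.mulVec x i = ∑ j, N i j * x j := fun i => rfl
    simp only [Pi.sub_apply, this, Matrix.one_apply, ite_mul, one_mul, zero_mul,
      Finset.sum_ite_eq, Finset.mem_univ, if_true, sub_zero, Pi.zero_apply]
    ring
  have hI : ∀ (c : Matrix ι ι ℝ) (b : ι → ℝ), Integrable
      (fun x : ι → ℝ => ∑ i, (∑ j, c i j * x j - b i) ^ 2) (stdGaussianPi ι) := fun c b =>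
    integrable_finsetSum _ fun i _ =>
      (memLp_affine_stdGaussianPi (fun j => c i j) (b i)).integrable_sq
  have hE : ∀ (c : Matrix ι ι ℝ) (b : ι → ℝ),
      ∫ x, ∑ i, (∑ j, c i j * x j - b i) ^ 2 ∂(stdGaussianPi ι) =
        ∑ i, (∑ j, c i j ^ 2 + b i ^ 2) := fun c b => by
    rw [integral_finsetSum _ fun i _ =>
      (memLp_affine_stdGaussianPi (fun j => c i j) (b i)).integrable_sq]
    exact Finset.sum_congr rfl fun i _ => integral_sq_affine_stdGaussianPi (fun j => c i j) (b i)
  have hI2 : Integrable (fun x : ι → ℝ => (∑ i, (∑ j, N i j * x j - N.mulVec a i) ^ 2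
        - ∑ i, (∑ j, (1 : Matrix ι ι ℝ) i j * x j - (0 : ι → ℝ) i) ^ 2) / 2)
      (stdGaussianPi ι) := ((hI N (N.mulVec a)).sub (hI 1 0)).div_const 2
  rw [klDiv_withDensity_ofReal (μ := volume) measurable_stdGaussianPiPDF
    (q := fun y => |N.det| * stdGaussianPiPDF (N.mulVec (y - a))) (by fun_prop)
    stdGaussianPiPDF_pos (fun y => mul_pos hN (stdGaussianPiPDF_pos _))
    stdGaussianPi_eq_withDensity (map_affine_stdGaussianPi a hMN)]
  · simp_rw [hlog]
    congr 1
    rw [integral_sub hI2 (integrable_const _), integral_div, integral_sub (hI _ _) (hI 1 0),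
      hE, hE]
    simp [Matrix.one_apply, Finset.sum_add_distrib]
  · simp_rw [hlog]
    exact hI2.sub (integrable_const _)

end density

/-! ### Closed forms of the two divergences and their common bound. -/

section gaussianKL

open scoped MatrixOrder

variable {ι : Type*} [Fintype ι] [DecidableEq ι]

lemma Matrix.PosDef.exists_symm_sqrt {S : Matrix ι ι ℝ} (hS : S.PosDef) :
    CFC.sqrt S * CFC.sqrt S = S ∧ (CFC.sqrt S).transpose = CFC.sqrt S := by
  refine ⟨CFC.sqrt_mul_sqrt_self _ hS.posSemidef.nonneg, ?_⟩
  have h : (CFC.sqrt S).conjTranspose = CFC.sqrt S := (CFC.sqrt_nonneg S).isSelfAdjoint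
  rwa [Matrix.conjTranspose_eq_transpose_of_trivial] at h

lemma multivariateGaussian_eq_map_stdGaussianPi (a : EuclideanSpace ℝ ι) (S : Matrix ι ι ℝ) :
    multivariateGaussian a S = ((stdGaussianPi ι).map
      fun x => a.ofLp + (CFC.sqrt S).mulVec x).map (WithLp.toLp 2) := by
  have hM : Measurable fun x : ι → ℝ => a.ofLp + (CFC.sqrt S).mulVec x :=
    (Continuous.matrix_mulVec continuous_const continuous_id).measurable.const_add _
  rw [multivariateGaussian, ← map_pi_eq_stdGaussian, Measure.map_map (by fun_prop) (by fun_prop),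
    Measure.map_map (by fun_prop) hM]
  rfl

omit [DecidableEq ι] in
lemma sum_sq_eq_trace_mul_self {N : Matrix ι ι ℝ} (hN : N.transpose = N) :
    ∑ i, ∑ j, N i j ^ 2 = (N * N).trace := by
  simp only [Matrix.trace, Matrix.diag, Matrix.mul_apply]
  refine Finset.sum_congr rfl fun i _ => Finset.sum_congr rfl fun j _ => ?_
  rw [sq]
  congr 1
  exact congrFun (congrFun hN.symm i) j

omit [Fintype ι] [DecidableEq ι] in
lemma klDiv_map_toLp (μ ν : Measure (ι → ℝ)) [IsFiniteMeasure μ] [IsFiniteMeasure ν] :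
    klDiv (μ.map (WithLp.toLp 2)) (ν.map (WithLp.toLp 2)) = klDiv μ ν :=
  klDiv_map_of_leftInverse (h := WithLp.ofLp) μ ν (by fun_prop) (by fun_prop) fun _ => rfl

theorem klDiv_stdGaussian_multivariateGaussian (a : EuclideanSpace ℝ ι) {S : Matrix ι ι ℝ}
    (hS : S.PosDef) :
    klDiv (stdGaussian (EuclideanSpace ℝ ι)) (multivariateGaussian a S) =
      ENNReal.ofReal ((S⁻¹.trace + a.ofLp ⬝ᵥ S⁻¹.mulVec a.ofLp - Fintype.card ι
        + Real.log S.det) / 2) := by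
  obtain ⟨hBB, hBt⟩ := hS.exists_symm_sqrt
  set B := CFC.sqrt S with hB
  have hdB : B.det * B.det = S.det := by rw [← Matrix.det_mul, hBB]
  have hdB0 : IsUnit B.det := by
    refine isUnit_iff_ne_zero.mpr fun h => hS.det_pos.ne' ?_
    rw [← hdB, h, zero_mul]
  have hM : Measurable fun x : ι → ℝ => a.ofLp + B.mulVec x :=
    (Continuous.matrix_mulVec continuous_const continuous_id).measurable.const_add _
  have : IsProbabilityMeasure ((stdGaussianPi ι).map fun x => a.ofLp + B.mulVec x) :=
    Measure.isProbabilityMeasure_map hM.aemeasurable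
  have hNt : B⁻¹.transpose = B⁻¹ := by rw [Matrix.transpose_nonsing_inv, hBt]
  have hNN : B⁻¹ * B⁻¹ = S⁻¹ := by rw [← Matrix.mul_inv_rev, hBB]
  rw [multivariateGaussian_eq_map_stdGaussianPi, ← map_pi_eq_stdGaussian, klDiv_map_toLp,
    klDiv_stdGaussianPi_map_affine _ (Matrix.mul_nonsing_inv _ hdB0),
    sum_sq_eq_trace_mul_self hNt, hNN]
  congr 1
  have h1 : ∑ i, (B⁻¹.mulVec a.ofLp) i ^ 2 = a.ofLp ⬝ᵥ S⁻¹.mulVec a.ofLp := by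
    rw [← hNN, ← Matrix.mulVec_mulVec, Matrix.dotProduct_mulVec, ← Matrix.mulVec_transpose, hNt]
    simp [dotProduct, sq]
  have h2 : Real.log |B⁻¹.det| = - (Real.log S.det / 2) := by
    rw [Real.log_abs, Matrix.det_nonsing_inv, Ring.inverse_eq_inv', Real.log_inv, ← hdB,
      Real.log_mul hdB0.ne_zero hdB0.ne_zero]
    ring
  rw [h1, h2]
  ring

/-- Pushing both measures forward by the inverse affine map makes the first argument standard, so
the formula for the other direction applies with the roles of `B` and `B⁻¹` exchanged. -/
theorem klDiv_multivariateGaussian_stdGaussian (a : EuclideanSpace ℝ ι) {S : Matrix ι ι ℝ}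
    (hS : S.PosDef) :
    klDiv (multivariateGaussian a S) (stdGaussian (EuclideanSpace ℝ ι)) =
      ENNReal.ofReal ((S.trace + a.ofLp ⬝ᵥ a.ofLp - Fintype.card ι - Real.log S.det) / 2) := by
  obtain ⟨hBB, hBt⟩ := hS.exists_symm_sqrt
  set B := CFC.sqrt S with hB
  have hdB : B.det * B.det = S.det := by rw [← Matrix.det_mul, hBB]
  have hdB0 : IsUnit B.det := by
    refine isUnit_iff_ne_zero.mpr fun h => hS.det_pos.ne' ?_
    rw [← hdB, h, zero_mul]
  have hM : Measurable fun x : ι → ℝ => a.ofLp + B.mulVec x :=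
    (Continuous.matrix_mulVec continuous_const continuous_id).measurable.const_add _
  have hT : Measurable fun x : ι → ℝ => -B⁻¹.mulVec a.ofLp + B⁻¹.mulVec x :=
    (Continuous.matrix_mulVec continuous_const continuous_id).measurable.const_add _
  have : IsProbabilityMeasure ((stdGaussianPi ι).map fun x => a.ofLp + B.mulVec x) :=
    Measure.isProbabilityMeasure_map hM.aemeasurable
  have hNB : B⁻¹ * B = 1 := Matrix.nonsing_inv_mul _ hdB0
  have hBN : B * B⁻¹ = 1 := Matrix.mul_nonsing_inv _ hdB0
  have hl : Function.LeftInverse (fun x => a.ofLp + B.mulVec x)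
      (fun x : ι → ℝ => -B⁻¹.mulVec a.ofLp + B⁻¹.mulVec x) := fun x => by
    simp [Matrix.mulVec_add, Matrix.mulVec_neg, Matrix.mulVec_mulVec, hBN]
  have hcomp : ((fun x : ι → ℝ => -B⁻¹.mulVec a.ofLp + B⁻¹.mulVec x) ∘
      fun x => a.ofLp + B.mulVec x) = id := by
    ext x i
    simp [Matrix.mulVec_add, Matrix.mulVec_mulVec, hNB]
  rw [multivariateGaussian_eq_map_stdGaussianPi, ← map_pi_eq_stdGaussian, klDiv_map_toLp,
    ← klDiv_map_of_leftInverse _ _ hT hM hl, Measure.map_map hT hM, hcomp, Measure.map_id,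
    klDiv_stdGaussianPi_map_affine _ hNB, sum_sq_eq_trace_mul_self hBt, hBB]
  congr 1
  have h1 : ∑ i, (B.mulVec (-B⁻¹.mulVec a.ofLp)) i ^ 2 = a.ofLp ⬝ᵥ a.ofLp := by
    rw [Matrix.mulVec_neg, Matrix.mulVec_mulVec, hBN, Matrix.one_mulVec]
    simp [dotProduct, sq]
  have h2 : Real.log |B.det| = Real.log S.det / 2 := by
    rw [Real.log_abs, ← hdB, Real.log_mul hdB0.ne_zero hdB0.ne_zero]
    ring
  rw [h1, h2]
  ring

/-- This is `log x ≤ x - 1` summed over the eigenvalues. -/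
lemma Matrix.PosDef.log_det_le {S : Matrix ι ι ℝ} (hS : S.PosDef) :
    Real.log S.det ≤ S.trace - Fintype.card ι := by
  rw [hS.isHermitian.det_eq_prod_eigenvalues, hS.isHermitian.trace_eq_sum_eigenvalues]
  simp only [RCLike.ofReal_real_eq_id, id]
  rw [Real.log_prod fun i _ => (hS.eigenvalues_pos i).ne']
  calc _ ≤ ∑ i, (hS.isHermitian.eigenvalues i - 1) :=
        Finset.sum_le_sum fun i _ => Real.log_le_sub_one_of_pos (hS.eigenvalues_pos i)
    _ = _ := by simp

/-- With `w = S⁻¹ v`, the hypothesis reads `c |w|² ≤ v ⬝ w`. Cauchy-Schwarz then gives `c (v ⬝ w)² ≤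
|v|² (v ⬝ w)`, and one factor `v ⬝ w` cancels. -/
lemma dotProduct_inv_mulVec_le {S : Matrix ι ι ℝ} (hS : S.PosDef) {c : ℝ} (hc : 0 < c)
    (h : ∀ v, c * (v ⬝ᵥ v) ≤ v ⬝ᵥ S.mulVec v) (v : ι → ℝ) :
    v ⬝ᵥ S⁻¹.mulVec v ≤ c⁻¹ * (v ⬝ᵥ v) := by
  have hu : IsUnit S.det := isUnit_iff_ne_zero.mpr hS.det_pos.ne'
  set w := S⁻¹.mulVec v with hw
  have hSw : S.mulVec w = v := by
    rw [hw, Matrix.mulVec_mulVec, Matrix.mul_nonsing_inv _ hu, Matrix.one_mulVec]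
  have h1 := h w
  rw [hSw, dotProduct_comm w v] at h1
  have hww : 0 ≤ w ⬝ᵥ w := Finset.sum_nonneg fun i _ => mul_self_nonneg _
  have hvv : 0 ≤ v ⬝ᵥ v := Finset.sum_nonneg fun i _ => mul_self_nonneg _
  have h2 : (v ⬝ᵥ w) ^ 2 ≤ (v ⬝ᵥ v) * (w ⬝ᵥ w) := by
    have := Finset.sum_mul_sq_le_sq_mul_sq Finset.univ v w
    simpa [dotProduct, sq] using this
  have h3 : 0 ≤ v ⬝ᵥ w := le_trans (by positivity) h1
  rw [inv_mul_eq_div, le_div_iff₀ hc]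
  rcases h3.eq_or_lt with h0 | h0
  · rw [← h0]; simpa using hvv
  · refine le_of_mul_le_mul_right ?_ h0
    nlinarith

/-- The left side is the trace of `(S - 1) S⁻¹ (S - 1)`, hence quadratic in `S - 1`. The bound on
the form of `S⁻¹` is applied to each row of `S - 1`. -/
lemma trace_add_trace_inv_le {S : Matrix ι ι ℝ} (hS : S.PosDef) {c : ℝ} (hc : 0 < c)
    (h : ∀ v, c * (v ⬝ᵥ v) ≤ v ⬝ᵥ S.mulVec v) :
    S.trace + S⁻¹.trace - 2 * Fintype.card ι ≤
      c⁻¹ * ∑ i, ∑ j, (S i j - (1 : Matrix ι ι ℝ) i j) ^ 2 := by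
  have hu : IsUnit S.det := isUnit_iff_ne_zero.mpr hS.det_pos.ne'
  have hSt : S.transpose = S := by
    rw [← Matrix.conjTranspose_eq_transpose_of_trivial]; exact hS.isHermitian
  have hDt : (S - 1).transpose = S - 1 := by rw [Matrix.transpose_sub, hSt, Matrix.transpose_one]
  have h1 : (S - 1) * (S⁻¹ * (S - 1)) = S + S⁻¹ - (2 : ℝ) • 1 := by
    rw [Matrix.mul_sub, Matrix.nonsing_inv_mul _ hu, Matrix.mul_one, Matrix.sub_mul,
      Matrix.mul_sub, Matrix.mul_nonsing_inv _ hu, Matrix.mul_one, Matrix.one_mul, two_smul]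
    abel
  have h2 : S.trace + S⁻¹.trace - 2 * Fintype.card ι =
      ((S - 1) * (S⁻¹ * (S - 1))).trace := by
    rw [h1, Matrix.trace_sub, Matrix.trace_add, Matrix.trace_smul, Matrix.trace_one]
    simp
  rw [h2, Finset.mul_sum]
  refine Finset.sum_le_sum fun i _ => ?_
  have h3 := dotProduct_inv_mulVec_le hS hc h (fun j => (S - 1) i j)
  refine le_trans (le_of_eq ?_) (h3.trans (le_of_eq ?_))
  · rw [Matrix.diag_apply, Matrix.mul_apply]
    refine Finset.sum_congr rfl fun j _ => ?_
    congr 1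
    rw [Matrix.mul_apply]
    refine Finset.sum_congr rfl fun k _ => ?_
    congr 1
    exact congrFun (congrFun hDt.symm k) i
  · simp [dotProduct, sq]

/-- The squared distance of a mean and a covariance matrix from those of the standard Gaussian
measure. -/
def gaussianDeviation (a : EuclideanSpace ℝ ι) (S : Matrix ι ι ℝ) : ℝ :=
  ∑ i, ∑ j, (S i j - (1 : Matrix ι ι ℝ) i j) ^ 2 + ∑ i, a i ^ 2

lemma gaussianDeviation_nonneg (a : EuclideanSpace ℝ ι) (S : Matrix ι ι ℝ) :
    0 ≤ gaussianDeviation a S := by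
  unfold gaussianDeviation; positivity

theorem klDiv_stdGaussian_multivariateGaussian_le (a : EuclideanSpace ℝ ι) {S : Matrix ι ι ℝ}
    (hS : S.PosDef) {c : ℝ} (hc : 0 < c) (h : ∀ v, c * (v ⬝ᵥ v) ≤ v ⬝ᵥ S.mulVec v) :
    klDiv (stdGaussian (EuclideanSpace ℝ ι)) (multivariateGaussian a S) ≤
      ENNReal.ofReal ((1 + c⁻¹) * gaussianDeviation a S) := by
  rw [klDiv_stdGaussian_multivariateGaussian a hS]
  refine ENNReal.ofReal_le_ofReal ?_
  have h1 := trace_add_trace_inv_le hS hc h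
  have h2 := hS.log_det_le
  have h3 := dotProduct_inv_mulVec_le hS hc h a.ofLp
  have h4 : a.ofLp ⬝ᵥ a.ofLp = ∑ i, a i ^ 2 := by simp [dotProduct, sq]
  have h5 : 0 ≤ gaussianDeviation a S := gaussianDeviation_nonneg a S
  have h6 : 0 ≤ c⁻¹ * gaussianDeviation a S := by positivity
  have h7 : c⁻¹ * gaussianDeviation a S = c⁻¹ * ∑ i, ∑ j, (S i j - (1 : Matrix ι ι ℝ) i j) ^ 2 +
    c⁻¹ * ∑ i, a i ^ 2 := by unfold gaussianDeviation; ring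
  rw [h4] at h3
  linarith

theorem klDiv_multivariateGaussian_stdGaussian_le (a : EuclideanSpace ℝ ι) {S : Matrix ι ι ℝ}
    (hS : S.PosDef) {c : ℝ} (hc : 0 < c) (h : ∀ v, c * (v ⬝ᵥ v) ≤ v ⬝ᵥ S.mulVec v) :
    klDiv (multivariateGaussian a S) (stdGaussian (EuclideanSpace ℝ ι)) ≤
      ENNReal.ofReal ((1 + c⁻¹) * gaussianDeviation a S) := by
  rw [klDiv_multivariateGaussian_stdGaussian a hS]
  refine ENNReal.ofReal_le_ofReal ?_
  have h1 := trace_add_trace_inv_le hS hc h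
  -- Here `-log det S` has to be bounded, so the inequality is applied to `S⁻¹`. Both directions
  -- then lead to `tr S + tr S⁻¹ - 2n`.
  have h2 := hS.inv.log_det_le
  rw [Matrix.det_nonsing_inv, Ring.inverse_eq_inv', Real.log_inv] at h2
  have h4 : a.ofLp ⬝ᵥ a.ofLp = ∑ i, a i ^ 2 := by simp [dotProduct, sq]
  have h8 : 0 ≤ ∑ i, ∑ j, (S i j - (1 : Matrix ι ι ℝ) i j) ^ 2 := by positivity
  have h9 : 0 ≤ ∑ i, a i ^ 2 := by positivity
  have h10 : 0 ≤ c⁻¹ * ∑ i, a i ^ 2 := by positivity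
  have h11 : 0 ≤ c⁻¹ * ∑ i, ∑ j, (S i j - (1 : Matrix ι ι ℝ) i j) ^ 2 := by positivity
  rw [h4, gaussianDeviation]
  nlinarith

end gaussianKL

/-! ### Negative moments of Gaussian determinants. -/

section invSqrt

/-- The function `x ↦ |x| ^ (-1/2)`, with value `∞` at `0`. -/
noncomputable def invSqrtAbs (x : ℝ) : ℝ≥0∞ := ENNReal.ofReal |x| ^ (-(1 / 2) : ℝ)

@[fun_prop]
lemma measurable_invSqrtAbs : Measurable invSqrtAbs := by
  unfold invSqrtAbs; fun_prop

lemma gaussianReal_zero_one_le_volume : gaussianReal 0 1 ≤ volume := by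
  rw [gaussianReal_of_var_ne_zero _ one_ne_zero]
  conv_rhs => rw [← withDensity_one (μ := (volume : Measure ℝ))]
  refine withDensity_mono (ae_of_all _ fun x => ?_)
  rw [gaussianPDF, Pi.one_apply]
  refine ENNReal.ofReal_le_one.mpr ?_
  rw [gaussianPDFReal]
  have h1 : (√(2 * Real.pi * (1 : NNReal)))⁻¹ ≤ 1 := by
    refine inv_le_one_of_one_le₀ (Real.one_le_sqrt.mpr ?_)
    have := Real.pi_gt_three
    simp only [NNReal.coe_one]
    linarith
  have h2 : Real.exp (-(x - 0) ^ 2 / (2 * (1 : NNReal))) ≤ 1 := by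
    rw [Real.exp_le_one_iff]
    have : 0 ≤ (x - 0) ^ 2 := sq_nonneg _
    simp only [NNReal.coe_one]
    linarith
  exact mul_le_one₀ h1 (Real.exp_pos _).le h2

/-- A bound for the mean of `|t + u| ^ (-1/2)` with `t` standard Gaussian. -/
noncomputable def invSqrtAbsBound : ℝ≥0∞ :=
  2 * (∫⁻ s in Set.Ioo (0 : ℝ) 1, invSqrtAbs s) + 1

lemma invSqrtAbsBound_ne_top : invSqrtAbsBound ≠ ∞ := by
  have h : IntegrableOn (fun x : ℝ => x ^ (-(1 / 2) : ℝ)) (Set.Ioo (0 : ℝ) 1) :=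
    (intervalIntegral.integrableOn_Ioo_rpow_iff one_pos).mpr (by norm_num)
  have h2 : ∫⁻ s in Set.Ioo (0 : ℝ) 1, invSqrtAbs s =
      ∫⁻ s in Set.Ioo (0 : ℝ) 1, ‖s ^ (-(1 / 2) : ℝ)‖ₑ := by
    refine setLIntegral_congr_fun measurableSet_Ioo fun s hs => ?_
    simp only [invSqrtAbs]
    rw [abs_of_pos hs.1, ENNReal.ofReal_rpow_of_pos hs.1,
      Real.enorm_of_nonneg (Real.rpow_nonneg hs.1.le _)]
  have h3 : ∫⁻ s in Set.Ioo (0 : ℝ) 1, invSqrtAbs s ≠ ∞ := by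
    rw [h2]; exact h.hasFiniteIntegral.ne
  exact ENNReal.add_ne_top.mpr ⟨ENNReal.mul_ne_top (by simp) h3, by simp⟩

lemma invSqrtAbsBound_ne_zero : invSqrtAbsBound ≠ 0 := by
  simp [invSqrtAbsBound]

/-- The Gaussian density is at most `1`, so the singular part is dominated by a Lebesgue integral,
where translation invariance removes `u`. Away from the singularity the integrand is at most `1`. -/
lemma lintegral_invSqrtAbs_add_le (u : ℝ) :
    ∫⁻ t, invSqrtAbs (t + u) ∂(gaussianReal 0 1) ≤ invSqrtAbsBound := by
  set g : ℝ → ℝ≥0∞ := (Set.Ioo (0 : ℝ) 1).indicator invSqrtAbs with hg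
  have hgm : Measurable g := measurable_invSqrtAbs.indicator measurableSet_Ioo
  have hpt : ∀ s : ℝ, s ≠ 0 → invSqrtAbs s ≤ g s + g (-s) + 1 := fun s hs => by
    by_cases h : |s| < 1
    · rcases lt_or_gt_of_ne hs with h0 | h0
      · have : -s ∈ Set.Ioo (0 : ℝ) 1 := ⟨by linarith, by rwa [abs_of_neg h0] at h⟩
        rw [hg, Set.indicator_of_mem this, invSqrtAbs, invSqrtAbs, abs_neg]
        exact le_add_right le_add_self
      · have : s ∈ Set.Ioo (0 : ℝ) 1 := ⟨h0, by rwa [abs_of_pos h0] at h⟩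
        rw [hg, Set.indicator_of_mem this]
        exact le_add_right le_self_add
    · refine le_add_left ?_
      rw [invSqrtAbs, ENNReal.rpow_neg]
      refine ENNReal.inv_le_one.mpr (ENNReal.one_le_rpow ?_ (by norm_num))
      rw [← ENNReal.ofReal_one]
      exact ENNReal.ofReal_le_ofReal (not_lt.mp h)
  have hac : gaussianReal 0 1 ≪ volume :=
    Measure.absolutelyContinuous_of_le gaussianReal_zero_one_le_volume
  have hae : ∀ᵐ t ∂(gaussianReal 0 1), invSqrtAbs (t + u) ≤ (g (t + u) + g (-(t + u))) + 1 := by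
    refine hac.ae_le ?_
    have : ∀ᵐ t : ℝ, t ≠ -u := by simp [ae_iff]
    filter_upwards [this] with t ht
    exact hpt _ fun h => ht (by linarith)
  have hgint : ∫⁻ s, g s = ∫⁻ s in Set.Ioo (0 : ℝ) 1, invSqrtAbs s :=
    lintegral_indicator measurableSet_Ioo _
  calc ∫⁻ t, invSqrtAbs (t + u) ∂(gaussianReal 0 1)
      ≤ ∫⁻ t, ((g (t + u) + g (-(t + u))) + 1) ∂(gaussianReal 0 1) := lintegral_mono_ae hae
    _ = ∫⁻ t, (g (t + u) + g (-(t + u))) ∂(gaussianReal 0 1) + 1 := by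
        rw [lintegral_add_right _ measurable_const]; simp
    _ ≤ (∫⁻ t, (g (t + u) + g (-(t + u)))) + 1 :=
        add_le_add_left (lintegral_mono' gaussianReal_zero_one_le_volume le_rfl) 1
    _ = ((∫⁻ s, g s) + ∫⁻ s, g (-s)) + 1 := by
        rw [lintegral_add_left (by fun_prop), lintegral_add_right_eq_self g u,
          lintegral_add_right_eq_self (fun s => g (-s)) u]
    _ = invSqrtAbsBound := by
        rw [lintegral_neg_eq_self, hgint, invSqrtAbsBound]; ring

lemma lintegral_invSqrtAbs_affine_le (c b : ℝ) :
    ∫⁻ t, invSqrtAbs (c * t + b) ∂(gaussianReal 0 1) ≤ invSqrtAbsBound * invSqrtAbs c := by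
  by_cases hc : c = 0
  -- In the degenerate case the right side is `∞`; this needs `invSqrtAbsBound ≠ 0`.
  · have : invSqrtAbs c = ∞ := by simp [invSqrtAbs, hc]
    rw [this, ENNReal.mul_top invSqrtAbsBound_ne_zero]
    exact le_top
  · have h : ∀ t, invSqrtAbs (c * t + b) = invSqrtAbs c * invSqrtAbs (t + b / c) := fun t => by
      rw [invSqrtAbs, invSqrtAbs, invSqrtAbs, show c * t + b = c * (t + b / c) by field_simp,
        abs_mul, ENNReal.ofReal_mul (abs_nonneg _),
        ENNReal.mul_rpow_of_ne_top ENNReal.ofReal_ne_top ENNReal.ofReal_ne_top]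
    simp_rw [h]
    rw [lintegral_const_mul _ (by fun_prop), mul_comm]
    gcongr
    exact lintegral_invSqrtAbs_add_le _

/-- Coordinate `i` is integrated first; the other coordinates only shift it, and the one-dimensional
bound does not see the shift. -/
lemma lintegral_invSqrtAbs_linear_le {m : ℕ} (c : Fin m → ℝ) (b : ℝ) (i : Fin m) :
    ∫⁻ x, invSqrtAbs (∑ j, c j * x j + b) ∂(stdGaussianPi (Fin m)) ≤
      invSqrtAbsBound * invSqrtAbs (c i) := by
  obtain ⟨m, rfl⟩ : ∃ k, m = k + 1 := ⟨m - 1, by have := i.pos; omega⟩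
  have hmp := measurePreserving_piFinSuccAbove (fun _ : Fin (m + 1) => gaussianReal 0 1) i
  have hF : Measurable fun p : ℝ × (Fin m → ℝ) =>
      invSqrtAbs (c i * p.1 + (∑ j, c (i.succAbove j) * p.2 j + b)) := by fun_prop
  have h : ∀ x : Fin (m + 1) → ℝ, invSqrtAbs (∑ j, c j * x j + b) =
      (fun p : ℝ × (Fin m → ℝ) => invSqrtAbs (c i * p.1 + (∑ j, c (i.succAbove j) * p.2 j + b)))
        (MeasurableEquiv.piFinSuccAbove (fun _ => ℝ) i x) := fun x => by
    rw [Fin.sum_univ_succAbove _ i, add_assoc]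
    rfl
  rw [lintegral_congr h, hmp.lintegral_comp hF, lintegral_prod_symm _ hF.aemeasurable]
  dsimp only
  refine (lintegral_mono fun y => lintegral_invSqrtAbs_affine_le (c i) _).trans ?_
  simp

/-- The mean of `|det (Z + M)| ^ (-1/2)` over matrices `Z` with independent standard Gaussian
entries is bounded uniformly in `M`. -/
lemma lintegral_invSqrtAbs_det_le {m : ℕ} : ∀ {n : ℕ} {e : Fin n → Fin m}
    (_ : Function.Injective e) (M : Matrix (Fin n) (Fin n) ℝ),
    ∫⁻ Z, invSqrtAbs (Matrix.of fun i j => Z i (e j) + M i j).det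
      ∂(Measure.pi fun _ : Fin n => stdGaussianPi (Fin m)) ≤ invSqrtAbsBound ^ n
  | 0, e, _, M => by simp [invSqrtAbs]
  | n + 1, e, he, M => by
    have hmp := measurePreserving_piFinSuccAbove
      (fun _ : Fin (n + 1) => stdGaussianPi (Fin m)) 0
    set A : (Fin n → Fin m → ℝ) → Matrix (Fin n) (Fin (n + 1)) ℝ := fun Z =>
      Matrix.of fun i j => Z i (e j) + M i.succ j with hA
    -- The cofactors of the first row. They depend on the remaining rows only, so given those the
    -- determinant is affine in the first row.
    set k : (Fin n → Fin m → ℝ) → Fin (n + 1) → ℝ := fun Z j =>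
      (-1) ^ (j : ℕ) * ((A Z).submatrix id j.succAbove).det with hk
    have hkm : ∀ j, Measurable fun Z => k Z j := fun j => by
      refine Measurable.const_mul (Continuous.measurable ?_) _
      refine Continuous.matrix_det (continuous_matrix fun a b => ?_)
      simp only [hA, Matrix.submatrix_apply, Matrix.of_apply]
      fun_prop
    have hF : Measurable fun p : (Fin m → ℝ) × (Fin n → Fin m → ℝ) =>
        invSqrtAbs (∑ j, k p.2 j * (p.1 (e j) + M 0 j)) := by
      have : ∀ j, Measurable fun p : (Fin m → ℝ) × (Fin n → Fin m → ℝ) => k p.2 j :=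
        fun j => (hkm j).comp measurable_snd
      fun_prop
    have h : ∀ Z : Fin (n + 1) → Fin m → ℝ,
        invSqrtAbs (Matrix.of fun i j => Z i (e j) + M i j).det =
        (fun p : (Fin m → ℝ) × (Fin n → Fin m → ℝ) =>
          invSqrtAbs (∑ j, k p.2 j * (p.1 (e j) + M 0 j)))
          (MeasurableEquiv.piFinSuccAbove (fun _ => Fin m → ℝ) 0 Z) := fun Z => by
      rw [Matrix.det_succ_row_zero]
      simp only [hk, hA]
      congr 1
      refine Finset.sum_congr rfl fun j _ => ?_
      rw [mul_right_comm]
      rfl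
    rw [lintegral_congr h, hmp.lintegral_comp hF, lintegral_prod_symm _ hF.aemeasurable]
    have hrow : ∀ Z : Fin n → Fin m → ℝ,
        ∫⁻ x, invSqrtAbs (∑ j, k Z j * (x (e j) + M 0 j)) ∂(stdGaussianPi (Fin m)) ≤
          invSqrtAbsBound * invSqrtAbs (k Z 0) := fun Z => by
      -- The cofactors are transported along `e` to coefficients on the whole row. Only the one at
      -- `e 0` is kept in the bound; it is a minor of size `n` on the columns `e ∘ succ`, which is
      -- why the induction carries a general injection `e`.
      set c : Fin m → ℝ := fun l => ∑ j, if e j = l then k Z j else 0 with hc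
      have hc0 : c (e 0) = k Z 0 := by simp [hc, he.eq_iff]
      rw [← hc0]
      refine le_trans (le_of_eq ?_)
        (lintegral_invSqrtAbs_linear_le c (∑ j, k Z j * M 0 j) (e 0))
      refine lintegral_congr fun x => ?_
      congr 1
      simp only [mul_add, Finset.sum_add_distrib, hc, Finset.sum_mul, ite_mul, zero_mul]
      rw [Finset.sum_comm]
      simp
    refine (lintegral_mono hrow).trans ?_
    have hk0 : Measurable fun Z => invSqrtAbs (k Z 0) := measurable_invSqrtAbs.comp (hkm 0)
    rw [lintegral_const_mul _ hk0, pow_succ']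
    gcongr
    refine le_trans (le_of_eq ?_) (lintegral_invSqrtAbs_det_le
      (e := fun j => e j.succ) (he.comp (Fin.succ_injective n)) (M.submatrix Fin.succ Fin.succ))
    refine lintegral_congr fun Z => ?_
    simp only [hk, hA, Fin.val_zero, pow_zero, one_mul]
    rfl

end invSqrt

/-! ### A small negative moment of the spectral bound for one block. -/

section gramBound

/-- A lower bound for half the smallest eigenvalue of `Gᵀ G`. -/
noncomputable def gramBound {n : ℕ} (G : Matrix (Fin n) (Fin n) ℝ) : ℝ :=
  G.det ^ 2 / (2 * (1 + ∑ i, ∑ j, G.adjugate i j ^ 2))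

lemma gramBound_nonneg {n : ℕ} (G : Matrix (Fin n) (Fin n) ℝ) : 0 ≤ gramBound G := by
  unfold gramBound; positivity

/-- From `adj(G) G v = det(G) v` and Cauchy-Schwarz on the rows of the adjugate. The factor `1 / 2`
is spent later in `(a - b)² / 2 ≤ a² + b²`. -/
lemma gramBound_mul_le {n : ℕ} (G : Matrix (Fin n) (Fin n) ℝ) (v : Fin n → ℝ) :
    gramBound G * (v ⬝ᵥ v) ≤ (1 / 2) * (G.mulVec v ⬝ᵥ G.mulVec v) := by
  set u := G.mulVec v with hu
  set F := ∑ i, ∑ j, G.adjugate i j ^ 2 with hF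
  have hF0 : 0 ≤ F := by positivity
  have huu : 0 ≤ u ⬝ᵥ u := Finset.sum_nonneg fun i _ => mul_self_nonneg _
  have h1 : G.adjugate.mulVec u = G.det • v := by
    rw [hu, Matrix.mulVec_mulVec, Matrix.adjugate_mul, Matrix.smul_mulVec, Matrix.one_mulVec]
  have h2 : G.det ^ 2 * (v ⬝ᵥ v) ≤ F * (u ⬝ᵥ u) := by
    calc G.det ^ 2 * (v ⬝ᵥ v) = ∑ i, (G.adjugate.mulVec u i) ^ 2 := by
          rw [h1]
          simp only [dotProduct, Pi.smul_apply, smul_eq_mul, Finset.mul_sum]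
          exact Finset.sum_congr rfl fun i _ => by ring
      _ ≤ ∑ i, (∑ j, G.adjugate i j ^ 2) * (u ⬝ᵥ u) := by
          refine Finset.sum_le_sum fun i _ => ?_
          have := Finset.sum_mul_sq_le_sq_mul_sq Finset.univ (fun j => G.adjugate i j) u
          simpa [dotProduct, Matrix.mulVec, sq] using this
      _ = F * (u ⬝ᵥ u) := by rw [hF, Finset.sum_mul]
  rw [gramBound, div_mul_eq_mul_div, div_le_iff₀ (by positivity)]
  nlinarith

/-- With `F` the denominator, the left side is `|det G|^(-1/4) F^(1/8)`. It is split by `xy ≤ x² +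
y²`, and `F^(1/4) ≤ F` because `F ≥ 1`. The exponent `1/8` is chosen so that only `|det G|^(-1/2)`
is needed. -/
lemma ofReal_gramBound_rpow_le {n : ℕ} (G : Matrix (Fin n) (Fin n) ℝ) :
    ENNReal.ofReal (gramBound G) ^ (-(1 / 8) : ℝ) ≤
      invSqrtAbs G.det + ENNReal.ofReal (2 * (1 + ∑ i, ∑ j, G.adjugate i j ^ 2)) := by
  set F := 2 * (1 + ∑ i, ∑ j, G.adjugate i j ^ 2) with hF
  have hS : 0 ≤ ∑ i, ∑ j, G.adjugate i j ^ 2 := by positivity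
  have hF1 : 1 ≤ F := by linarith
  by_cases h : G.det = 0
  · simp [invSqrtAbs, h]
  have hd : 0 < |G.det| := abs_pos.mpr h
  have hg : gramBound G = |G.det| ^ 2 / F := by rw [gramBound, sq_abs]
  have hgp : 0 < gramBound G := by rw [hg]; positivity
  rw [invSqrtAbs, ENNReal.ofReal_rpow_of_pos hgp, ENNReal.ofReal_rpow_of_pos hd,
    ← ENNReal.ofReal_add (by positivity) (by positivity)]
  refine ENNReal.ofReal_le_ofReal ?_
  have h1 : gramBound G ^ (-(1 / 8) : ℝ) = |G.det| ^ (-(1 / 4) : ℝ) * F ^ (1 / 8 : ℝ) := by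
    rw [hg, Real.div_rpow (by positivity) (by positivity), ← Real.rpow_natCast,
      ← Real.rpow_mul hd.le, div_eq_mul_inv, ← Real.rpow_neg (by positivity)]
    norm_num
  have h2 : |G.det| ^ (-(1 / 2) : ℝ) = (|G.det| ^ (-(1 / 4) : ℝ)) ^ 2 := by
    rw [← Real.rpow_natCast, ← Real.rpow_mul hd.le]; norm_num
  have h3 : (F ^ (1 / 8 : ℝ)) ^ 2 ≤ F := by
    rw [← Real.rpow_natCast, ← Real.rpow_mul (by positivity)]
    calc F ^ _ ≤ F ^ (1 : ℝ) := Real.rpow_le_rpow_of_exponent_le hF1 (by norm_num)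
      _ = F := Real.rpow_one F
  rw [h1, h2]
  nlinarith [sq_nonneg (|G.det| ^ (-(1 / 4) : ℝ) - F ^ (1 / 8 : ℝ)),
    sq_nonneg (|G.det| ^ (-(1 / 4) : ℝ) + F ^ (1 / 8 : ℝ))]

/-- The matrix whose rows are the differences of two families of vectors. -/
def rowDiff {n : ℕ} (w : Fin n ⊕ Fin n → Fin n → ℝ) : Matrix (Fin n) (Fin n) ℝ :=
  Matrix.of fun i j => w (.inl i) j - w (.inr i) j

lemma continuous_rowDiff {n : ℕ} : Continuous (rowDiff (n := n)) :=
  continuous_matrix fun i j => by simp only [rowDiff, Matrix.of_apply]; fun_prop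

lemma measurable_gramBound_rowDiff {n : ℕ} :
    Measurable fun w : Fin n ⊕ Fin n → Fin n → ℝ => gramBound (rowDiff w) := by
  unfold gramBound
  have h1 : Continuous fun w : Fin n ⊕ Fin n → Fin n → ℝ => (rowDiff w).det :=
    Continuous.matrix_det continuous_rowDiff
  have h3 : ∀ i j, Continuous fun w : Fin n ⊕ Fin n → Fin n → ℝ => (rowDiff w).adjugate i j :=
    fun i j => (Continuous.matrix_adjugate continuous_rowDiff).matrix_elem i j
  refine (h1.pow 2).measurable.div (Continuous.measurable ?_)
  exact continuous_const.mul (continuous_const.add (continuous_finsetSum _ fun i _ =>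
    continuous_finsetSum _ fun j _ => (h3 i j).pow 2))

/-- An adjugate entry is the determinant of `G` with one row replaced by a unit vector, so `1 ≤ x`
keeps all entries below `x`. -/
lemma abs_adjugate_le {n : ℕ} {G : Matrix (Fin n) (Fin n) ℝ} {x : ℝ} (hx1 : 1 ≤ x)
    (hx : ∀ i j, |G i j| ≤ x) (i j : Fin n) : |G.adjugate i j| ≤ n.factorial * x ^ n := by
  rw [Matrix.adjugate_apply]
  have := Matrix.det_le (A := G.updateRow j (Pi.single i 1))
    (abv := (AbsoluteValue.abs : AbsoluteValue ℝ ℝ)) (x := x) fun a b => by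
      rw [Matrix.updateRow_apply]
      split_ifs
      · rw [Pi.single_apply]
        split_ifs <;> simp <;> linarith
      · exact hx a b
  simpa using this

lemma memLp_coord_pi_stdGaussianPi {β ι : Type*} [Fintype β] [Fintype ι] (b : β) (i : ι)
    (p : ℝ≥0∞) (hp : p ≠ ∞) :
    MemLp (fun w : β → ι → ℝ => w b i) p (Measure.pi fun _ : β => stdGaussianPi ι) :=
  (memLp_eval_stdGaussianPi i p hp).comp_measurePreserving
    (measurePreserving_eval (fun _ : β => stdGaussianPi ι) b)

lemma memLp_one_add_sum_abs_sub {n : ℕ} (p : ℝ≥0∞) (hp : p ≠ ∞) :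
    MemLp (fun w : Fin n ⊕ Fin n → Fin n → ℝ =>
      1 + ∑ a, ∑ b, |w (.inl a) b - w (.inr a) b|) p
      (Measure.pi fun _ : Fin n ⊕ Fin n => stdGaussianPi (Fin n)) := by
  have h1 : ∀ a b, MemLp (fun w : Fin n ⊕ Fin n → Fin n → ℝ => |w (.inl a) b - w (.inr a) b|)
      p (Measure.pi fun _ : Fin n ⊕ Fin n => stdGaussianPi (Fin n)) := fun a b =>
    ((memLp_coord_pi_stdGaussianPi (Sum.inl a) b p hp).sub
      (memLp_coord_pi_stdGaussianPi (Sum.inr a) b p hp)).abs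
  have h2 : ∀ a, MemLp (fun w : Fin n ⊕ Fin n → Fin n → ℝ =>
      ∑ b, |w (.inl a) b - w (.inr a) b|) p
      (Measure.pi fun _ : Fin n ⊕ Fin n => stdGaussianPi (Fin n)) := fun a =>
    memLp_finsetSum _ fun b _ => h1 a b
  have h3 : MemLp (fun w : Fin n ⊕ Fin n → Fin n → ℝ =>
      ∑ a, ∑ b, |w (.inl a) b - w (.inr a) b|) p
      (Measure.pi fun _ : Fin n ⊕ Fin n => stdGaussianPi (Fin n)) :=
    memLp_finsetSum _ fun a _ => h2 a
  have h4 : MemLp (fun _ : Fin n ⊕ Fin n → Fin n → ℝ => (1 : ℝ)) p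
      (Measure.pi fun _ : Fin n ⊕ Fin n => stdGaussianPi (Fin n)) := memLp_const _
  exact h4.add h3

lemma abs_rowDiff_le {n : ℕ} (w : Fin n ⊕ Fin n → Fin n → ℝ) (a b : Fin n) :
    |rowDiff w a b| ≤ 1 + ∑ a, ∑ b, |w (.inl a) b - w (.inr a) b| := by
  have h1 : |w (.inl a) b - w (.inr a) b| ≤ ∑ b, |w (.inl a) b - w (.inr a) b| :=
    Finset.single_le_sum (f := fun b => |w (.inl a) b - w (.inr a) b|)
      (fun _ _ => abs_nonneg _) (Finset.mem_univ b)
  have h2 : ∑ b, |w (.inl a) b - w (.inr a) b| ≤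
      ∑ a, ∑ b, |w (.inl a) b - w (.inr a) b| :=
    Finset.single_le_sum (f := fun a => ∑ b, |w (.inl a) b - w (.inr a) b|)
      (fun _ _ => Finset.sum_nonneg fun _ _ => abs_nonneg _) (Finset.mem_univ a)
  simp only [rowDiff, Matrix.of_apply]
  linarith

lemma integrable_adjugate_rowDiff_sq {n : ℕ} (i j : Fin n) :
    Integrable (fun w => (rowDiff w).adjugate i j ^ 2)
      (Measure.pi fun _ : Fin n ⊕ Fin n => stdGaussianPi (Fin n)) := by
  have hXi := (memLp_one_add_sum_abs_sub (n := n) ((2 * n : ℕ) : ℝ≥0∞)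
    (ENNReal.natCast_ne_top _)).integrable_norm_pow'
  have hm : AEStronglyMeasurable (fun w => (rowDiff w).adjugate i j ^ 2)
      (Measure.pi fun _ : Fin n ⊕ Fin n => stdGaussianPi (Fin n)) :=
    (((Continuous.matrix_adjugate continuous_rowDiff).matrix_elem i j).pow 2).aestronglyMeasurable
  refine (hXi.const_mul ((n.factorial : ℝ) ^ 2)).mono' hm (ae_of_all _ fun w => ?_)
  have h0 : 0 ≤ ∑ a, ∑ b, |w (.inl a) b - w (.inr a) b| := by positivity
  have := abs_adjugate_le (by linarith) (abs_rowDiff_le w) i j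
  rw [Real.norm_eq_abs, abs_pow, Real.norm_eq_abs,
    abs_of_pos (by linarith : 0 < 1 + ∑ a, ∑ b, |w (.inl a) b - w (.inr a) b|),
    mul_comm 2 n, pow_mul, ← mul_pow]
  exact pow_le_pow_left₀ (abs_nonneg _) this 2

/-- A negative moment of `gramBound` of a difference of two standard Gaussian matrices. -/
noncomputable def gramBoundMoment (n : ℕ) : ℝ≥0∞ :=
  ∫⁻ w, ENNReal.ofReal (gramBound (rowDiff w)) ^ (-(1 / 8) : ℝ)
    ∂(Measure.pi fun _ : Fin n ⊕ Fin n => stdGaussianPi (Fin n))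

/-- Freezing the second family turns it into a deterministic shift; uniformity in the shift is what
makes the later integration over `y` harmless. -/
lemma lintegral_invSqrtAbs_det_sub_le {n : ℕ} (y : Fin n → Fin n → ℝ) :
    ∫⁻ x : Fin n → Fin n → ℝ, invSqrtAbs (Matrix.of fun i j => x i j + -y i j).det
      ∂(Measure.pi fun _ : Fin n => stdGaussianPi (Fin n)) ≤ invSqrtAbsBound ^ n :=
  lintegral_invSqrtAbs_det_le (e := fun j => j)
    Function.injective_id (Matrix.of fun i j => -y i j)

lemma measurePreserving_sum_stdGaussianPi (n : ℕ) :
    MeasurePreserving (MeasurableEquiv.sumPiEquivProdPi fun _ : Fin n ⊕ Fin n => (Fin n → ℝ))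
      (Measure.pi fun _ : Fin n ⊕ Fin n => stdGaussianPi (Fin n))
      ((Measure.pi fun _ : Fin n => stdGaussianPi (Fin n)).prod
        (Measure.pi fun _ : Fin n => stdGaussianPi (Fin n))) :=
  measurePreserving_sumPiEquivProdPi (fun _ : Fin n ⊕ Fin n => stdGaussianPi (Fin n))

lemma lintegral_invSqrtAbs_det_rowDiff_le (n : ℕ) :
    ∫⁻ w, invSqrtAbs (rowDiff w).det
      ∂(Measure.pi fun _ : Fin n ⊕ Fin n => stdGaussianPi (Fin n)) ≤ invSqrtAbsBound ^ n := by
  have hF : Measurable fun p : (Fin n → Fin n → ℝ) × (Fin n → Fin n → ℝ) =>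
      invSqrtAbs (Matrix.of fun i j => p.1 i j + -p.2 i j).det := by
    refine measurable_invSqrtAbs.comp (Continuous.measurable (Continuous.matrix_det ?_))
    refine continuous_matrix fun i j => ?_
    change Continuous fun p : (Fin n → Fin n → ℝ) × (Fin n → Fin n → ℝ) => p.1 i j + -p.2 i j
    fun_prop
  have hrow : ∀ w : Fin n ⊕ Fin n → Fin n → ℝ, rowDiff w = Matrix.of fun i j =>
      (MeasurableEquiv.sumPiEquivProdPi (fun _ => Fin n → ℝ) w).1 i j +
        -(MeasurableEquiv.sumPiEquivProdPi (fun _ => Fin n → ℝ) w).2 i j := fun w => by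
    ext i j
    exact sub_eq_add_neg _ _
  have h : ∀ w : Fin n ⊕ Fin n → Fin n → ℝ, invSqrtAbs (rowDiff w).det =
      (fun p : (Fin n → Fin n → ℝ) × (Fin n → Fin n → ℝ) =>
        invSqrtAbs (Matrix.of fun i j => p.1 i j + -p.2 i j).det)
        (MeasurableEquiv.sumPiEquivProdPi (fun _ => Fin n → ℝ) w) := fun w => by rw [hrow w]
  rw [lintegral_congr h, (measurePreserving_sum_stdGaussianPi n).lintegral_comp hF,
    lintegral_prod_symm _ hF.aemeasurable]
  refine (lintegral_mono fun y => lintegral_invSqrtAbs_det_sub_le y).trans ?_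
  rw [lintegral_const, measure_univ, mul_one]

lemma gramBoundMoment_ne_top (n : ℕ) : gramBoundMoment n ≠ ∞ := by
  set μ := Measure.pi fun _ : Fin n ⊕ Fin n => stdGaussianPi (Fin n)
  have hI1 : ∀ i, Integrable (fun w => ∑ j, (rowDiff w).adjugate i j ^ 2) μ := fun i =>
    integrable_finsetSum _ fun j _ => integrable_adjugate_rowDiff_sq i j
  have hI2 : Integrable (fun w => ∑ i, ∑ j, (rowDiff w).adjugate i j ^ 2) μ :=
    integrable_finsetSum _ fun i _ => hI1 i
  have hI : Integrable (fun w => 2 * (1 + ∑ i, ∑ j, (rowDiff w).adjugate i j ^ 2)) μ :=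
    ((integrable_const 1).add hI2).const_mul 2
  have hm : Measurable fun w : Fin n ⊕ Fin n → Fin n → ℝ => invSqrtAbs (rowDiff w).det :=
    measurable_invSqrtAbs.comp (Continuous.matrix_det continuous_rowDiff).measurable
  refine ne_top_of_le_ne_top ?_ (lintegral_mono fun w => ofReal_gramBound_rpow_le (rowDiff w))
  rw [lintegral_add_left hm]
  refine ENNReal.add_ne_top.mpr ⟨?_, ?_⟩
  · exact ne_top_of_le_ne_top (ENNReal.pow_ne_top invSqrtAbsBound_ne_top)
      (lintegral_invSqrtAbs_det_rowDiff_le n)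
  · exact hI.lintegral_lt_top.ne

end gramBound

/-! ### Inverse fourth moment of a sum over independent blocks. -/

section blocks

/-- Injectivity of `σ` makes the blocks disjoint, hence independent with the same law. -/
lemma lintegral_prod_blocks {κ β α E : Type*} [Fintype κ] [Fintype β] [Fintype α]
    [MeasurableSpace E] (μ : Measure E) [IsProbabilityMeasure μ] {σ : κ × β → α}
    (hσ : Function.Injective σ) {f : (β → E) → ℝ≥0∞} (hf : Measurable f) :
    ∫⁻ z, ∏ k, f (fun b => z (σ (k, b))) ∂(Measure.pi fun _ : α => μ) =
      (∫⁻ w, f w ∂(Measure.pi fun _ : β => μ)) ^ Fintype.card κ := by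
  have h1 : (Measure.pi fun _ : α => μ).map (fun z p => z (σ p)) =
      Measure.pi fun _ : κ × β => μ := by
    simp_rw [← Measure.infinitePi_eq_pi]
    exact Measure.map_infinitePi_infinitePi_of_inj (P := fun _ : α => μ) hσ
  have h2 : (Measure.pi fun _ : κ × β => μ).map (MeasurableEquiv.curry κ β E) =
      Measure.pi fun _ : κ => Measure.pi fun _ : β => μ := by
    simp_rw [← Measure.infinitePi_eq_pi]
    exact Measure.infinitePi_map_curry fun _ _ => μ
  have h3 : (Measure.pi fun _ : α => μ).map (fun z k b => z (σ (k, b))) =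
      Measure.pi fun _ : κ => Measure.pi fun _ : β => μ := by
    rw [← h2, ← h1, Measure.map_map (MeasurableEquiv.measurable _) (by fun_prop)]
    rfl
  have hF : Measurable fun y : κ → β → E => ∏ k, f (y k) :=
    Finset.measurable_prod _ fun k _ => hf.comp (measurable_pi_apply k)
  have h4 := lintegral_map (μ := Measure.pi fun _ : α => μ) hF
    (g := fun z k b => z (σ (k, b))) (by fun_prop)
  rw [← h4, h3]
  have hind : iIndepFun (fun (k : κ) (y : κ → β → E) => f (y k))
      (Measure.pi fun _ : κ => Measure.pi fun _ : β => μ) :=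
    iIndepFun_pi fun k => hf.aemeasurable
  rw [lintegral_prod_eq_prod_lintegral_of_indepFun _ _ hind fun k =>
    hf.comp (measurable_pi_apply k)]
  have h5 : ∀ k, ∫⁻ y : κ → β → E, f (y k) ∂(Measure.pi fun _ : κ => Measure.pi fun _ : β => μ) =
      ∫⁻ w, f w ∂(Measure.pi fun _ : β => μ) := fun k =>
    (measurePreserving_eval (fun _ : κ => Measure.pi fun _ : β => μ) k).lintegral_comp hf
  simp_rw [h5]
  simp

/-- AM-GM in the form `K (∏ qₖ)^(1/K) ≤ ∑ qₖ`, raised to the power `-4`. The product on the right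
factorizes under independence. -/
lemma ofReal_sum_rpow_neg_le {K : ℕ} (hK : 0 < K) {q : Fin K → ℝ} (hq : ∀ k, 0 ≤ q k) :
    ENNReal.ofReal (∑ k, q k) ^ (-4 : ℝ) ≤
      (K : ℝ≥0∞) ^ (-4 : ℝ) * ∏ k, ENNReal.ofReal (q k) ^ (-(4 / K) : ℝ) := by
  have hK' : (0 : ℝ) < K := Nat.cast_pos.mpr hK
  have h1 := Real.geom_mean_le_arith_mean_weighted Finset.univ (fun _ : Fin K => (1 / K : ℝ)) q
    (fun _ _ => by positivity) (by simp [hK'.ne']) fun k _ => hq k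
  rw [← Finset.mul_sum, one_div, inv_mul_eq_div, le_div_iff₀ hK'] at h1
  have h2 : (∏ k, ENNReal.ofReal (q k) ^ (K : ℝ)⁻¹) * K ≤ ENNReal.ofReal (∑ k, q k) := by
    refine le_trans (le_of_eq ?_) (ENNReal.ofReal_le_ofReal h1)
    rw [ENNReal.ofReal_mul (Finset.prod_nonneg fun k _ => Real.rpow_nonneg (hq k) _),
      ENNReal.ofReal_prod_of_nonneg fun k _ => Real.rpow_nonneg (hq k) _, ENNReal.ofReal_natCast]
    congr 1
    exact Finset.prod_congr rfl fun k _ =>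
      ENNReal.ofReal_rpow_of_nonneg (hq k) (inv_nonneg.mpr hK'.le)
  calc _ ≤ ((∏ k, ENNReal.ofReal (q k) ^ (K : ℝ)⁻¹) * K) ^ (-4 : ℝ) := by
        rw [ENNReal.rpow_neg, ENNReal.rpow_neg]
        exact ENNReal.inv_le_inv.mpr (ENNReal.rpow_le_rpow h2 (by norm_num))
    _ = _ := by
        have hne : ∀ k, ENNReal.ofReal (q k) ^ (K : ℝ)⁻¹ ≠ ∞ := fun k =>
          ENNReal.rpow_ne_top_of_nonneg (by positivity) ENNReal.ofReal_ne_top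
        rw [ENNReal.mul_rpow_of_ne_top (ENNReal.prod_ne_top fun k _ => hne k)
          (ENNReal.natCast_ne_top K), mul_comm]
        congr 1
        rw [← ENNReal.prod_rpow_of_ne_top fun k _ => hne k]
        refine Finset.prod_congr rfl fun k _ => ?_
        rw [← ENNReal.rpow_mul]
        congr 1
        field_simp

/-- Monotonicity of `L^p` norms of `q⁻¹` on a probability space between `p = 4/K` and `p = 1/8`,
raised to the fourth power. The condition `4/K ≤ 1/8` is `32 ≤ K`. -/
lemma lintegral_rpow_neg_pow_le {n K : ℕ} (hK : 32 ≤ K) :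
    (∫⁻ w, ENNReal.ofReal (gramBound (rowDiff w)) ^ (-(4 / K) : ℝ)
      ∂(Measure.pi fun _ : Fin n ⊕ Fin n => stdGaussianPi (Fin n))) ^ K ≤
      gramBoundMoment n ^ 32 := by
  have hK' : (32 : ℝ) ≤ K := by exact_mod_cast hK
  have hK0 : (0 : ℝ) < K := by linarith
  set μ := Measure.pi fun _ : Fin n ⊕ Fin n => stdGaussianPi (Fin n)
  set F : (Fin n ⊕ Fin n → Fin n → ℝ) → ℝ≥0∞ := fun w =>
    (ENNReal.ofReal (gramBound (rowDiff w)))⁻¹ with hF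
  have hFm : Measurable F :=
    measurable_gramBound_rowDiff.ennreal_ofReal.inv
  have h := eLpNorm'_le_eLpNorm'_of_exponent_le (p := 4 / K) (q := 1 / 8) (f := F) (by positivity)
    (by rw [div_le_div_iff₀ hK0 (by norm_num)]; linarith) μ hFm.aestronglyMeasurable
  simp only [eLpNorm', enorm_eq_self, hF] at h
  have h2 := ENNReal.rpow_le_rpow h (z := 4) (by norm_num)
  rw [← ENNReal.rpow_mul, ← ENNReal.rpow_mul] at h2
  have e1 : 1 / (4 / (K : ℝ)) * 4 = (K : ℕ) := by field_simp
  have e2 : 1 / (1 / 8 : ℝ) * 4 = (32 : ℕ) := by norm_num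
  rw [e1, e2, ENNReal.rpow_natCast, ENNReal.rpow_natCast] at h2
  simp_rw [ENNReal.inv_rpow, ← ENNReal.rpow_neg] at h2
  exact h2

/-- The mean of the fourth power of the inverse of `∑ₖ gramBound Gₖ`, where the `Gₖ` are formed
from disjoint blocks of independent standard Gaussian vectors. -/
lemma lintegral_sum_gramBound_rpow_neg_le {n K : ℕ} (hK : 32 ≤ K) {α : Type*} [Fintype α]
    {σ : Fin K × (Fin n ⊕ Fin n) → α} (hσ : Function.Injective σ) :
    ∫⁻ z, ENNReal.ofReal (∑ k, gramBound (rowDiff fun b => z (σ (k, b)))) ^ (-4 : ℝ)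
      ∂(Measure.pi fun _ : α => stdGaussianPi (Fin n)) ≤
      (K : ℝ≥0∞) ^ (-4 : ℝ) * gramBoundMoment n ^ 32 := by
  have hm : Measurable fun w : Fin n ⊕ Fin n → Fin n → ℝ =>
      ENNReal.ofReal (gramBound (rowDiff w)) ^ (-(4 / K) : ℝ) :=
    measurable_gramBound_rowDiff.ennreal_ofReal.pow_const _
  have hp : Measurable fun z : α → Fin n → ℝ =>
      ∏ k, ENNReal.ofReal (gramBound (rowDiff fun b => z (σ (k, b)))) ^ (-(4 / K) : ℝ) :=
    Finset.measurable_prod _ fun k _ => hm.comp (by fun_prop)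
  refine (lintegral_mono fun z => ofReal_sum_rpow_neg_le (by omega)
    fun k => gramBound_nonneg _).trans ?_
  rw [lintegral_const_mul _ hp]
  gcongr
  rw [lintegral_prod_blocks (stdGaussianPi (Fin n)) hσ hm, Fintype.card_fin]
  exact lintegral_rpow_neg_pow_le hK

end blocks

/-! ### Calculus of uniformly bounded moments. -/

section boundedMoments

/-- The random variables `Y J` have moments of all orders, bounded uniformly in `J`. -/
def HasBoundedMoments {Ω : ℕ → Type*} [∀ J, MeasurableSpace (Ω J)] (P : ∀ J, Measure (Ω J))
    (Y : ∀ J, Ω J → ℝ) : Prop :=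
  (∀ J, Measurable (Y J)) ∧ ∀ k : ℕ, ∃ C : ℝ≥0∞, C ≠ ∞ ∧ ∀ J, ∫⁻ x, ‖Y J x‖ₑ ^ k ∂(P J) ≤ C

variable {Ω : ℕ → Type*} [∀ J, MeasurableSpace (Ω J)] {P : ∀ J, Measure (Ω J)}

lemma HasBoundedMoments.add {X Y : ∀ J, Ω J → ℝ} (hX : HasBoundedMoments P X)
    (hY : HasBoundedMoments P Y) : HasBoundedMoments P fun J x => X J x + Y J x := by
  refine ⟨fun J => (hX.1 J).add (hY.1 J), fun k => ?_⟩
  obtain ⟨C, hC, h1⟩ := hX.2 k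
  obtain ⟨D, hD, h2⟩ := hY.2 k
  refine ⟨2 ^ k * (C + D), ENNReal.mul_ne_top (by simp) (ENNReal.add_ne_top.mpr ⟨hC, hD⟩),
    fun J => ?_⟩
  have hpt : ∀ a b : ℝ≥0∞, (a + b) ^ k ≤ 2 ^ k * (a ^ k + b ^ k) := fun a b => by
    rcases le_total a b with h | h
    · calc (a + b) ^ k ≤ (2 * b) ^ k := by gcongr; rw [two_mul]; gcongr
        _ ≤ _ := by rw [mul_pow]; gcongr; exact le_add_self
    · calc (a + b) ^ k ≤ (2 * a) ^ k := by gcongr; rw [two_mul]; gcongr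
        _ ≤ _ := by rw [mul_pow]; gcongr; exact le_self_add
  have hm : Measurable fun x => ‖X J x‖ₑ ^ k := (hX.1 J).enorm.pow_const k
  have hm' : Measurable fun x => ‖Y J x‖ₑ ^ k := (hY.1 J).enorm.pow_const k
  calc ∫⁻ x, ‖X J x + Y J x‖ₑ ^ k ∂(P J)
      ≤ ∫⁻ x, 2 ^ k * (‖X J x‖ₑ ^ k + ‖Y J x‖ₑ ^ k) ∂(P J) :=
        lintegral_mono fun x => (pow_le_pow_left' (enorm_add_le _ _) k).trans (hpt _ _)
    _ = 2 ^ k * (∫⁻ x, ‖X J x‖ₑ ^ k ∂(P J) + ∫⁻ x, ‖Y J x‖ₑ ^ k ∂(P J)) := by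
        have hmm : Measurable fun x => ‖X J x‖ₑ ^ k + ‖Y J x‖ₑ ^ k := hm.add hm'
        rw [lintegral_const_mul _ hmm, lintegral_add_left hm]
    _ ≤ _ := by gcongr; exacts [h1 J, h2 J]

lemma HasBoundedMoments.mul {X Y : ∀ J, Ω J → ℝ} (hX : HasBoundedMoments P X)
    (hY : HasBoundedMoments P Y) : HasBoundedMoments P fun J x => X J x * Y J x := by
  refine ⟨fun J => (hX.1 J).mul (hY.1 J), fun k => ?_⟩
  obtain ⟨C, hC, h1⟩ := hX.2 (k + k)
  obtain ⟨D, hD, h2⟩ := hY.2 (k + k)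
  refine ⟨C + D, ENNReal.add_ne_top.mpr ⟨hC, hD⟩, fun J => ?_⟩
  have hpt : ∀ a b : ℝ≥0∞, (a * b) ^ k ≤ a ^ (k + k) + b ^ (k + k) := fun a b => by
    rw [mul_pow, pow_add, pow_add]
    rcases le_total a b with h | h
    · exact le_add_left (by gcongr)
    · exact le_add_right (by gcongr)
  have hm : Measurable fun x => ‖X J x‖ₑ ^ (k + k) := (hX.1 J).enorm.pow_const _
  calc ∫⁻ x, ‖X J x * Y J x‖ₑ ^ k ∂(P J)
      ≤ ∫⁻ x, (‖X J x‖ₑ ^ (k + k) + ‖Y J x‖ₑ ^ (k + k)) ∂(P J) :=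
        lintegral_mono fun x => by rw [enorm_mul]; exact hpt _ _
    _ = ∫⁻ x, ‖X J x‖ₑ ^ (k + k) ∂(P J) + ∫⁻ x, ‖Y J x‖ₑ ^ (k + k) ∂(P J) :=
        lintegral_add_left hm _
    _ ≤ _ := by gcongr; exacts [h1 J, h2 J]

lemma hasBoundedMoments_const [∀ J, IsProbabilityMeasure (P J)] {c : ℕ → ℝ} {B : ℝ}
    (hc : ∀ J, |c J| ≤ B) : HasBoundedMoments P fun J _ => c J := by
  refine ⟨fun J => measurable_const, fun k => ⟨ENNReal.ofReal B ^ k, by simp, fun J => ?_⟩⟩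
  rw [lintegral_const, measure_univ, mul_one, Real.enorm_eq_ofReal_abs]
  gcongr
  exact hc J

lemma HasBoundedMoments.sum [∀ J, IsProbabilityMeasure (P J)] {ι : Type*} (s : Finset ι)
    {Y : ι → ∀ J, Ω J → ℝ} (hY : ∀ i, HasBoundedMoments P (Y i)) :
    HasBoundedMoments P fun J x => ∑ i ∈ s, Y i J x := by
  classical
  induction s using Finset.induction_on with
  | empty => simpa using hasBoundedMoments_const (P := P) (c := fun _ => 0) (B := 0) (by simp)
  | insert i s hi ih =>
    simp_rw [Finset.sum_insert hi]
    exact (hY i).add ih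

end boundedMoments

/-! ### Uniform moments of normalized sums. -/

section sums

lemma Real.exp_le_one_add_add_sq_mul_exp_abs (y : ℝ) :
    Real.exp y ≤ 1 + y + y ^ 2 * Real.exp |y| := by
  have h1 : Real.exp y - 1 ≤ y * Real.exp y := by
    have h := Real.add_one_le_exp (-y)
    have h2 : Real.exp (-y) * Real.exp y = 1 := by rw [← Real.exp_add]; simp
    nlinarith [Real.exp_pos y]
  rcases le_total 0 y with hy | hy
  · rw [abs_of_nonneg hy]
    have h2 := Real.one_le_exp hy
    have h3 : Real.exp y - 1 - y ≤ y * (Real.exp y - 1) := by linarith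
    nlinarith
  · have h2 := Real.add_one_le_exp y
    have h3 : 1 ≤ Real.exp |y| := Real.one_le_exp (abs_nonneg y)
    nlinarith [sq_nonneg y]

variable {E : Type*} [MeasurableSpace E] (μ : Measure E) [IsProbabilityMeasure μ]

/-- Second-order expansion of the exponential: centring kills the linear term. Half of the
exponential moment controls `exp |t f|`, the other half controls `f²`. -/
lemma lintegral_exp_mul_le {f : E → ℝ} (hf : Measurable f) (hmean : ∫ x, f x ∂μ = 0)
    {s : ℝ} (hs : 0 < s) (hint : Integrable (fun x => Real.exp (s * |f x|)) μ)
    {t : ℝ} (ht : |t| ≤ s / 2) :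
    ∫⁻ x, ENNReal.ofReal (Real.exp (t * f x)) ∂μ ≤
      ENNReal.ofReal (Real.exp (t ^ 2 * (8 / s ^ 2 * ∫ x, Real.exp (s * |f x|) ∂μ))) := by
  set M := ∫ x, Real.exp (s * |f x|) ∂μ with hM
  have hfi : Integrable f μ := by
    refine (hint.const_mul s⁻¹).mono' hf.aestronglyMeasurable (ae_of_all _ fun x => ?_)
    rw [Real.norm_eq_abs, inv_mul_eq_div, le_div_iff₀ hs, mul_comm]
    have := Real.add_one_le_exp (s * |f x|)
    linarith
  have hpt : ∀ x, Real.exp (t * f x) ≤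
      1 + t * f x + t ^ 2 * (8 / s ^ 2 * Real.exp (s * |f x|)) := fun x => by
    have h1 := Real.exp_le_one_add_add_sq_mul_exp_abs (t * f x)
    have h2 : Real.exp |t * f x| ≤ Real.exp (s / 2 * |f x|) := by
      rw [abs_mul]; gcongr
    have h3 : (s / 2 * |f x|) ^ 2 / 2 ≤ Real.exp (s / 2 * |f x|) := by
      have := Real.pow_div_factorial_le_exp (s / 2 * |f x|) (by positivity) 2
      simpa using this
    have h4 : Real.exp (s * |f x|) = Real.exp (s / 2 * |f x|) * Real.exp (s / 2 * |f x|) := by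
      rw [← Real.exp_add]; ring_nf
    have h5 : f x ^ 2 ≤ 8 / s ^ 2 * Real.exp (s / 2 * |f x|) := by
      have : f x ^ 2 = 8 / s ^ 2 * ((s / 2 * |f x|) ^ 2 / 2) := by
        rw [mul_pow, sq_abs]; field_simp; ring
      rw [this]; gcongr
    calc _ ≤ 1 + t * f x + t ^ 2 * f x ^ 2 * Real.exp |t * f x| := by rw [← mul_pow]; exact h1
      _ ≤ 1 + t * f x + t ^ 2 * (8 / s ^ 2 * Real.exp (s / 2 * |f x|)) *
          Real.exp (s / 2 * |f x|) := by gcongr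
      _ = _ := by rw [h4]; ring
  have hI1 : Integrable (fun x => 1 + t * f x) μ := (integrable_const _).add (hfi.const_mul t)
  have hI2 : Integrable (fun x => t ^ 2 * (8 / s ^ 2 * Real.exp (s * |f x|))) μ :=
    (hint.const_mul _).const_mul _
  calc ∫⁻ x, ENNReal.ofReal (Real.exp (t * f x)) ∂μ
      ≤ ∫⁻ x, ENNReal.ofReal (1 + t * f x + t ^ 2 * (8 / s ^ 2 * Real.exp (s * |f x|))) ∂μ :=
        lintegral_mono fun x => ENNReal.ofReal_le_ofReal (hpt x)
    _ = ENNReal.ofReal (∫ x, (1 + t * f x + t ^ 2 * (8 / s ^ 2 * Real.exp (s * |f x|))) ∂μ) := by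
        exact (ofReal_integral_eq_lintegral_ofReal (hI1.add hI2)
          (ae_of_all _ fun x => (Real.exp_pos _).le.trans (hpt x))).symm
    _ = ENNReal.ofReal (1 + t ^ 2 * (8 / s ^ 2 * M)) := by
        rw [integral_add hI1 hI2, integral_add (integrable_const _) (hfi.const_mul t),
          integral_const_mul, integral_const_mul, integral_const_mul, hmean]
        simp [hM]
    _ ≤ _ := by
        refine ENNReal.ofReal_le_ofReal ?_
        have := Real.add_one_le_exp (t ^ 2 * (8 / s ^ 2 * M))
        linarith

lemma lintegral_exp_sum_le {f : E → ℝ} (hf : Measurable f) (hmean : ∫ x, f x ∂μ = 0)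
    {s : ℝ} (hs : 0 < s) (hint : Integrable (fun x => Real.exp (s * |f x|)) μ) {J : ℕ}
    {t : ℝ} (ht : |t| ≤ s / 2) (htJ : t ^ 2 * J ≤ s ^ 2 / 4) :
    ∫⁻ x, ENNReal.ofReal (Real.exp (t * ∑ i : Fin J, f (x i))) ∂(Measure.pi fun _ => μ) ≤
      ENNReal.ofReal (Real.exp (2 * ∫ x, Real.exp (s * |f x|) ∂μ)) := by
  set M := ∫ x, Real.exp (s * |f x|) ∂μ with hM
  have hM0 : 0 ≤ M := integral_nonneg fun x => (Real.exp_pos _).le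
  have hg : Measurable fun x => ENNReal.ofReal (Real.exp (t * f x)) := by fun_prop
  have h1 : ∀ x : Fin J → E, ENNReal.ofReal (Real.exp (t * ∑ i, f (x i))) =
      ∏ i, ENNReal.ofReal (Real.exp (t * f (x i))) := fun x => by
    rw [Finset.mul_sum, Real.exp_sum, ENNReal.ofReal_prod_of_nonneg fun _ _ => (Real.exp_pos _).le]
  have hind : iIndepFun (fun (i : Fin J) (x : Fin J → E) =>
      ENNReal.ofReal (Real.exp (t * f (x i)))) (Measure.pi fun _ => μ) :=
    iIndepFun_pi fun _ => hg.aemeasurable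
  have h5 : ∀ i : Fin J, ∫⁻ x : Fin J → E, ENNReal.ofReal (Real.exp (t * f (x i)))
      ∂(Measure.pi fun _ => μ) = ∫⁻ x, ENNReal.ofReal (Real.exp (t * f x)) ∂μ := fun i =>
    (measurePreserving_eval (fun _ : Fin J => μ) i).lintegral_comp hg
  simp_rw [h1]
  rw [lintegral_prod_eq_prod_lintegral_of_indepFun _ _ hind fun i =>
    hg.comp (measurable_pi_apply i)]
  simp_rw [h5]
  rw [Finset.prod_const, Finset.card_univ, Fintype.card_fin]
  calc _ ≤ ENNReal.ofReal (Real.exp (t ^ 2 * (8 / s ^ 2 * M))) ^ J := by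
        gcongr; exact lintegral_exp_mul_le μ hf hmean hs hint ht
    _ = ENNReal.ofReal (Real.exp ((t ^ 2 * J) * (8 / s ^ 2 * M))) := by
        rw [← ENNReal.ofReal_pow (Real.exp_pos _).le, ← Real.exp_nat_mul]; ring_nf
    _ ≤ ENNReal.ofReal (Real.exp ((s ^ 2 / 4) * (8 / s ^ 2 * M))) := by gcongr
    _ = _ := by congr 2; field_simp; ring

/-- Normalized sums of independent identically distributed centred random variables with an
exponential moment have uniformly bounded moments. -/
theorem hasBoundedMoments_normalized_sum {f : E → ℝ} (hf : Measurable f)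
    (hmean : ∫ x, f x ∂μ = 0) {s : ℝ} (hs : 0 < s)
    (hint : Integrable (fun x => Real.exp (s * |f x|)) μ) :
    HasBoundedMoments (fun J => Measure.pi fun _ : Fin J => μ)
      fun J x => (√J)⁻¹ * ∑ i, f (x i) := by
  refine ⟨fun J => by fun_prop, fun k => ?_⟩
  set M := ∫ x, Real.exp (s * |f x|) ∂μ with hM
  refine ⟨ENNReal.ofReal (k.factorial / (s / 2) ^ k) *
    (ENNReal.ofReal (Real.exp (2 * M)) + ENNReal.ofReal (Real.exp (2 * M))),
    ENNReal.mul_ne_top (by simp) (by simp), fun J => ?_⟩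
  -- This scale makes `t² J` bounded, so the `J` factors of the moment generating function multiply
  -- to a constant. For `J = 0` it is `0`.
  set t := s / 2 * (√J)⁻¹ with ht
  have ht1 : |t| ≤ s / 2 := by
    rw [ht, abs_of_nonneg (by positivity)]
    refine mul_le_of_le_one_right (by positivity) ?_
    rcases Nat.eq_zero_or_pos J with h | h
    · simp [h]
    · refine inv_le_one_of_one_le₀ (Real.one_le_sqrt.mpr ?_)
      exact_mod_cast h
  have ht2 : t ^ 2 * J ≤ s ^ 2 / 4 := by
    rw [ht, mul_pow, inv_pow, Real.sq_sqrt (Nat.cast_nonneg J), mul_assoc]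
    have : ((J : ℝ))⁻¹ * J ≤ 1 := inv_mul_le_one
    nlinarith [sq_nonneg (s / 2)]
  have hpt : ∀ x : Fin J → E, ‖(√J)⁻¹ * ∑ i, f (x i)‖ₑ ^ k ≤
      ENNReal.ofReal (k.factorial / (s / 2) ^ k) *
        (ENNReal.ofReal (Real.exp (t * ∑ i, f (x i))) +
          ENNReal.ofReal (Real.exp (-t * ∑ i, f (x i)))) := fun x => by
    rw [Real.enorm_eq_ofReal_abs, ← ENNReal.ofReal_pow (abs_nonneg _),
      ← ENNReal.ofReal_add (Real.exp_pos _).le (Real.exp_pos _).le,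
      ← ENNReal.ofReal_mul (by positivity)]
    refine ENNReal.ofReal_le_ofReal ?_
    have h1 := Real.pow_div_factorial_le_exp |t * ∑ i, f (x i)| (abs_nonneg _) k
    have h2 : Real.exp |t * ∑ i, f (x i)| ≤
        Real.exp (t * ∑ i, f (x i)) + Real.exp (-t * ∑ i, f (x i)) := by
      rw [neg_mul]; exact Real.exp_abs_le _
    have h3 : |t * ∑ i, f (x i)| = s / 2 * |(√J)⁻¹ * ∑ i, f (x i)| := by
      rw [ht, mul_assoc, abs_mul, abs_of_pos (by positivity : 0 < s / 2)]
    rw [div_le_iff₀ (by positivity)] at h1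
    rw [h3, mul_pow, ← h3] at h1
    rw [div_mul_eq_mul_div, le_div_iff₀ (by positivity)]
    calc _ = (s / 2) ^ k * |(√J)⁻¹ * ∑ i, f (x i)| ^ k := mul_comm _ _
      _ ≤ _ := h1
      _ ≤ _ := by rw [mul_comm]; gcongr
  refine (lintegral_mono hpt).trans ?_
  rw [lintegral_const_mul _ (by fun_prop), lintegral_add_left (by fun_prop)]
  gcongr
  · exact lintegral_exp_sum_le μ hf hmean hs hint ht1 ht2
  · exact lintegral_exp_sum_le μ hf hmean hs hint (by rwa [abs_neg]) (by rwa [neg_sq])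

end sums

/-! ### Gaussian coordinates and their products as summands. -/

section gaussian

variable {ι : Type*} [Fintype ι] [DecidableEq ι]

omit [DecidableEq ι] in
lemma integral_coord_stdGaussianPi (a : ι) : ∫ x, x a ∂(stdGaussianPi ι) = 0 := by
  rw [integral_eval]; simp

lemma integral_coord_mul_coord_stdGaussianPi (a b : ι) :
    ∫ x, x a * x b ∂(stdGaussianPi ι) = (1 : Matrix ι ι ℝ) a b := by
  by_cases h : a = b
  · subst h
    have := integral_sq_affine_stdGaussianPi (Pi.single a 1 : ι → ℝ) 0
    simpa [Pi.single_apply, sq] using this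
  · have hind : iIndepFun (fun (i : ι) (x : ι → ℝ) => x i) (stdGaussianPi ι) :=
      iIndepFun_pi (X := fun _ x => x) fun _ => aemeasurable_id
    have h2 := (hind.indepFun h).integral_mul_eq_mul_integral
      (measurable_pi_apply a).aestronglyMeasurable (measurable_pi_apply b).aestronglyMeasurable
    have h3 : ∫ x, x a * x b ∂(stdGaussianPi ι) =
      (∫ x, x a ∂(stdGaussianPi ι)) * ∫ x, x b ∂(stdGaussianPi ι) := h2
    rw [h3, integral_coord_stdGaussianPi, zero_mul, Matrix.one_apply_ne h]

-- Fernique's theorem for the one-dimensional Gaussian; a square-exponential moment is needed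
-- because the covariance entries are quadratic in the sample.
omit [DecidableEq ι] in
lemma exists_integrable_exp_coord_sq :
    ∃ s, 0 < s ∧ ∀ a : ι, Integrable (fun x => Real.exp (s * x a ^ 2)) (stdGaussianPi ι) := by
  obtain ⟨s, hs, h⟩ := IsGaussian.exists_integrable_exp_sq (gaussianReal 0 1)
  refine ⟨s, hs, fun a => ?_⟩
  simp_rw [Real.norm_eq_abs, sq_abs] at h
  exact (measurePreserving_eval (fun _ : ι => gaussianReal 0 1) a).integrable_comp_of_integrable h

omit [DecidableEq ι] in
lemma hasBoundedMoments_coord_sum (a : ι) :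
    HasBoundedMoments (fun J => Measure.pi fun _ : Fin J => stdGaussianPi ι)
      fun J x => (√J)⁻¹ * ∑ i, x i a := by
  obtain ⟨s, hs, h⟩ := exists_integrable_exp_coord_sq (ι := ι)
  refine hasBoundedMoments_normalized_sum (stdGaussianPi ι) (f := fun x => x a) (by fun_prop)
    (integral_coord_stdGaussianPi a) hs ?_
  refine ((h a).const_mul (Real.exp s)).mono'
    (Measurable.aestronglyMeasurable (by fun_prop)) (ae_of_all _ fun x => ?_)
  rw [Real.norm_of_nonneg (Real.exp_pos _).le, ← Real.exp_add]
  refine Real.exp_le_exp.mpr ?_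
  have : |x a| ≤ 1 + x a ^ 2 := abs_le.mpr ⟨by nlinarith, by nlinarith⟩
  nlinarith

lemma hasBoundedMoments_coord_mul_sum (a b : ι) :
    HasBoundedMoments (fun J => Measure.pi fun _ : Fin J => stdGaussianPi ι)
      fun J x => (√J)⁻¹ * ∑ i, (x i a * x i b - (1 : Matrix ι ι ℝ) a b) := by
  obtain ⟨s, hs, h⟩ := exists_integrable_exp_coord_sq (ι := ι)
  have hI : Integrable (fun x : ι → ℝ => x a * x b) (stdGaussianPi ι) :=
    (memLp_eval_stdGaussianPi a 2 (by simp)).integrable_mul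
      (memLp_eval_stdGaussianPi b 2 (by simp))
  refine hasBoundedMoments_normalized_sum (stdGaussianPi ι)
    (f := fun x => x a * x b - (1 : Matrix ι ι ℝ) a b) (by fun_prop) ?_ hs ?_
  · rw [integral_sub hI (integrable_const _), integral_coord_mul_coord_stdGaussianPi]
    simp
  refine (((h a).add (h b)).const_mul (Real.exp s)).mono'
    (Measurable.aestronglyMeasurable (by fun_prop)) (ae_of_all _ fun x => ?_)
  rw [Real.norm_of_nonneg (Real.exp_pos _).le]
  have h1 : |(1 : Matrix ι ι ℝ) a b| ≤ 1 := by
    rw [Matrix.one_apply]; split_ifs <;> simp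
  have h2 : |x a * x b - (1 : Matrix ι ι ℝ) a b| ≤ 1 + max (x a ^ 2) (x b ^ 2) := by
    have h3 := abs_sub (x a * x b) ((1 : Matrix ι ι ℝ) a b)
    have h4 : |x a * x b| ≤ max (x a ^ 2) (x b ^ 2) := by
      have h5 := le_max_left (x a ^ 2) (x b ^ 2)
      have h6 := le_max_right (x a ^ 2) (x b ^ 2)
      refine abs_le.mpr ⟨?_, ?_⟩
      · nlinarith [sq_nonneg (x a + x b)]
      · nlinarith [sq_nonneg (x a - x b)]
    linarith
  calc Real.exp (s * |x a * x b - (1 : Matrix ι ι ℝ) a b|)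
      ≤ Real.exp (s + s * max (x a ^ 2) (x b ^ 2)) := by
        refine Real.exp_le_exp.mpr ?_
        nlinarith
    _ ≤ _ := by
        rw [Real.exp_add]
        refine mul_le_mul_of_nonneg_left ?_ (Real.exp_pos _).le
        have e1 := Real.exp_pos (s * x a ^ 2)
        have e2 := Real.exp_pos (s * x b ^ 2)
        simp only [Pi.add_apply]
        rcases max_cases (x a ^ 2) (x b ^ 2) with ⟨h, _⟩ | ⟨h, _⟩ <;> rw [h] <;> linarith

end gaussian

/-! ### Algebra of the sample mean and covariance. -/

section sample

variable {d J : ℕ}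

lemma sampleMean_apply (y : Fin J → EuclideanSpace ℝ (Fin d)) (a : Fin d) :
    sampleMean y a = (J : ℝ)⁻¹ * ∑ i, y i a := by
  simp [sampleMean]

lemma sampleCov_apply (y : Fin J → EuclideanSpace ℝ (Fin d)) (a b : Fin d) :
    sampleCov y a b = ((J : ℝ) - 1)⁻¹ *
      ∑ i, (y i a - sampleMean y a) * (y i b - sampleMean y b) := by
  simp [sampleCov, Matrix.sum_apply, Matrix.vecMulVec_apply]

lemma sampleCov_transpose (y : Fin J → EuclideanSpace ℝ (Fin d)) :
    (sampleCov y).transpose = sampleCov y := by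
  ext a b
  rw [Matrix.transpose_apply, sampleCov_apply, sampleCov_apply]
  simp_rw [mul_comm]

lemma dotProduct_sampleCov_mulVec (y : Fin J → EuclideanSpace ℝ (Fin d)) (v : Fin d → ℝ) :
    v ⬝ᵥ (sampleCov y).mulVec v =
      ((J : ℝ) - 1)⁻¹ * ∑ i, (∑ a, (y i a - sampleMean y a) * v a) ^ 2 := by
  simp only [dotProduct, Matrix.mulVec, sampleCov_apply]
  simp_rw [sq, Finset.sum_mul_sum, Finset.mul_sum, Finset.sum_mul, Finset.mul_sum]
  conv_rhs => rw [Finset.sum_comm]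
  refine Finset.sum_congr rfl fun a _ => ?_
  conv_rhs => rw [Finset.sum_comm]
  refine Finset.sum_congr rfl fun b _ => Finset.sum_congr rfl fun i _ => ?_
  ring

lemma sum_mul_sub_mean_mul_sub_mean (y : Fin J → EuclideanSpace ℝ (Fin d)) (hJ : J ≠ 0)
    (a b : Fin d) :
    ∑ i, (y i a - sampleMean y a) * (y i b - sampleMean y b) =
      ∑ i, y i a * y i b - (J : ℝ)⁻¹ * (∑ i, y i a) * ∑ i, y i b := by
  have hJ' : (J : ℝ) ≠ 0 := by exact_mod_cast hJ
  simp_rw [sampleMean_apply, sub_mul, mul_sub, Finset.sum_sub_distrib]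
  rw [← Finset.sum_mul, ← Finset.mul_sum, ← Finset.sum_mul, Finset.sum_const, Finset.card_univ,
    Fintype.card_fin, nsmul_eq_mul]
  field_simp
  ring

end sample

/-! ### The scatter form dominates the block bounds. -/

section scatter

variable {n J K : ℕ}

/-- The sum over blocks of `2 n` samples of the bounds `gramBound`. -/
noncomputable def blockGramBound (σ : Fin K × (Fin n ⊕ Fin n) → Fin J) (x : Fin J → Fin n → ℝ) :
    ℝ :=
  ∑ k, gramBound (rowDiff fun b => x (σ (k, b)))

lemma blockGramBound_nonneg (σ : Fin K × (Fin n ⊕ Fin n) → Fin J) (x : Fin J → Fin n → ℝ) :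
    0 ≤ blockGramBound σ x :=
  Finset.sum_nonneg fun _ _ => gramBound_nonneg _

lemma measurable_blockGramBound (σ : Fin K × (Fin n ⊕ Fin n) → Fin J) :
    Measurable (blockGramBound σ) :=
  Finset.measurable_sum _ fun k _ => measurable_gramBound_rowDiff.comp
    (g := fun w : Fin n ⊕ Fin n → Fin n → ℝ => gramBound (rowDiff w)) (by fun_prop)

/-- Differences inside a block cancel the centre `c`, which is therefore arbitrary. In particular
`c` may be the sample mean, which depends on all blocks, without destroying their independence. -/
lemma blockGramBound_mul_le {σ : Fin K × (Fin n ⊕ Fin n) → Fin J} (hσ : Function.Injective σ)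
    (x : Fin J → Fin n → ℝ) (v c : Fin n → ℝ) :
    blockGramBound σ x * (v ⬝ᵥ v) ≤ ∑ i, (∑ a, (x i a - c a) * v a) ^ 2 := by
  set w : Fin J → ℝ := fun i => ∑ a, (x i a - c a) * v a with hw
  have hG : ∀ k j, (rowDiff fun b => x (σ (k, b))).mulVec v j =
      w (σ (k, .inl j)) - w (σ (k, .inr j)) := fun k j => by
    simp only [hw, Matrix.mulVec, dotProduct, rowDiff, Matrix.of_apply, ← Finset.sum_sub_distrib]
    exact Finset.sum_congr rfl fun a _ => by ring
  calc blockGramBound σ x * (v ⬝ᵥ v)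
      ≤ ∑ k, ∑ b, w (σ (k, b)) ^ 2 := by
        rw [blockGramBound, Finset.sum_mul]
        refine Finset.sum_le_sum fun k _ => (gramBound_mul_le _ v).trans ?_
        rw [Fintype.sum_sum_type, ← Finset.sum_add_distrib, dotProduct, Finset.mul_sum]
        refine Finset.sum_le_sum fun j _ => ?_
        rw [hG]
        nlinarith [sq_nonneg (w (σ (k, .inl j)) + w (σ (k, .inr j)))]
    _ = ∑ p, w (σ p) ^ 2 := by rw [Fintype.sum_prod_type]
    _ = ∑ i ∈ Finset.univ.image σ, w i ^ 2 := by
        rw [Finset.sum_image fun a _ b _ h => hσ h]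
    _ ≤ ∑ i, w i ^ 2 :=
        Finset.sum_le_sum_of_subset_of_nonneg (Finset.subset_univ _) fun _ _ _ => sq_nonneg _

/-- The sample of vectors in Euclidean space with given coordinates. -/
def euclideanSample (x : Fin J → Fin n → ℝ) : Fin J → EuclideanSpace ℝ (Fin n) :=
  fun i => WithLp.toLp 2 (x i)

lemma mul_dotProduct_le_sampleCov (hJ : 2 ≤ J) {σ : Fin K × (Fin n ⊕ Fin n) → Fin J}
    (hσ : Function.Injective σ) (x : Fin J → Fin n → ℝ) (v : Fin n → ℝ) :
    ((J : ℝ) - 1)⁻¹ * blockGramBound σ x * (v ⬝ᵥ v) ≤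
      v ⬝ᵥ (sampleCov (euclideanSample x)).mulVec v := by
  have hJ' : (2 : ℝ) ≤ J := by exact_mod_cast hJ
  rw [dotProduct_sampleCov_mulVec, mul_assoc]
  have : (0 : ℝ) ≤ ((J : ℝ) - 1)⁻¹ := inv_nonneg.mpr (by linarith)
  exact mul_le_mul_of_nonneg_left
    (blockGramBound_mul_le hσ x v (sampleMean (euclideanSample x)).ofLp) this

lemma posDef_of_mul_dotProduct_le {S : Matrix (Fin n) (Fin n) ℝ} (hS : S.transpose = S) {c : ℝ}
    (hc : 0 < c) (h : ∀ v, c * (v ⬝ᵥ v) ≤ v ⬝ᵥ S.mulVec v) : S.PosDef := by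
  refine Matrix.PosDef.of_dotProduct_mulVec_pos ?_ fun v hv => ?_
  · rw [Matrix.IsHermitian, Matrix.conjTranspose_eq_transpose_of_trivial, hS]
  · rw [star_trivial]
    refine lt_of_lt_of_le (mul_pos hc ?_) (h v)
    refine lt_of_le_of_ne (Finset.sum_nonneg fun i _ => mul_self_nonneg _) fun h0 => hv ?_
    exact dotProduct_self_eq_zero.mp h0.symm

end scatter

/-! ### The squared deviation is of order `J⁻¹` in every moment. -/

section deviation

variable {n : ℕ}

/-- For `J = 1` the inverse of `0` is `0`, and `c 0 = 0` by the hypotheses, so the bound needs no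
restriction on `J`. -/
lemma abs_sub_one_inv_mul_le {c : ℕ → ℝ} (h0 : ∀ J : ℕ, 0 ≤ c J) (hc : ∀ J : ℕ, c J ≤ J)
    (J : ℕ) : |((J : ℝ) - 1)⁻¹ * c J| ≤ 2 := by
  match J with
  | 0 =>
    have h1 := hc 0
    have h2 := h0 0
    have h3 : c 0 = 0 := le_antisymm (by simpa using h1) h2
    simp [h3]
  | 1 => simp
  | J + 2 =>
    have h1 := hc (J + 2)
    have h2 := h0 (J + 2)
    have h3 : (0 : ℝ) ≤ J := Nat.cast_nonneg J
    push_cast at h1 ⊢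
    rw [abs_of_nonneg (by
      refine mul_nonneg (inv_nonneg.mpr (by linarith)) h2), inv_mul_eq_div, div_le_iff₀ (by linarith)]
    linarith

/-- `J` times the squared deviation of the sample mean and the sample covariance, as a
polynomial in normalized sums of centred random variables. -/
noncomputable def scaledDeviation (J : ℕ) (x : Fin J → Fin n → ℝ) : ℝ :=
  ∑ a, ∑ b,
    (((J : ℝ) - 1)⁻¹ * J * ((√J)⁻¹ * ∑ i, (x i a * x i b - (1 : Matrix (Fin n) (Fin n) ℝ) a b))
      + (((J : ℝ) - 1)⁻¹ * √J * (1 : Matrix (Fin n) (Fin n) ℝ) a b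
        + -(((J : ℝ) - 1)⁻¹ * √J) * (((√J)⁻¹ * ∑ i, x i a) * ((√J)⁻¹ * ∑ i, x i b)))) *
    (((J : ℝ) - 1)⁻¹ * J * ((√J)⁻¹ * ∑ i, (x i a * x i b - (1 : Matrix (Fin n) (Fin n) ℝ) a b))
      + (((J : ℝ) - 1)⁻¹ * √J * (1 : Matrix (Fin n) (Fin n) ℝ) a b
        + -(((J : ℝ) - 1)⁻¹ * √J) * (((√J)⁻¹ * ∑ i, x i a) * ((√J)⁻¹ * ∑ i, x i b))))
  + ∑ a, ((√J)⁻¹ * ∑ i, x i a) * ((√J)⁻¹ * ∑ i, x i a)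

lemma hasBoundedMoments_scaledDeviation :
    HasBoundedMoments (fun J => Measure.pi fun _ : Fin J => stdGaussianPi (Fin n))
      fun J x => scaledDeviation J x := by
  have hsqrt : ∀ J : ℕ, √(J : ℝ) ≤ J := fun J => by
    rcases Nat.eq_zero_or_pos J with h | h
    · simp [h]
    · have h1 : (1 : ℝ) ≤ J := by exact_mod_cast h
      rw [Real.sqrt_le_left (by linarith)]
      nlinarith
  have h1 : HasBoundedMoments (fun J => Measure.pi fun _ : Fin J => stdGaussianPi (Fin n))
      fun J _ => ((J : ℝ) - 1)⁻¹ * J := hasBoundedMoments_const (B := 2)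
    (abs_sub_one_inv_mul_le (c := fun J => J) (fun J => Nat.cast_nonneg J) fun J => le_rfl)
  have hB := abs_sub_one_inv_mul_le (c := fun J => √J) (fun J => Real.sqrt_nonneg _) hsqrt
  have h2 : HasBoundedMoments (fun J => Measure.pi fun _ : Fin J => stdGaussianPi (Fin n))
      fun J _ => ((J : ℝ) - 1)⁻¹ * √J := hasBoundedMoments_const hB
  have h3 : HasBoundedMoments (fun J => Measure.pi fun _ : Fin J => stdGaussianPi (Fin n))
      fun J _ => -(((J : ℝ) - 1)⁻¹ * √J) := hasBoundedMoments_const (B := 2) fun J => by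
    rw [abs_neg]; exact hB J
  have h4 : ∀ a b, HasBoundedMoments
      (fun J => Measure.pi fun _ : Fin J => stdGaussianPi (Fin n))
      fun _ _ => (1 : Matrix (Fin n) (Fin n) ℝ) a b := fun a b =>
    hasBoundedMoments_const (fun _ => le_rfl)
  have hT := fun a b => (h1.mul (hasBoundedMoments_coord_mul_sum a b)).add
    ((h2.mul (h4 a b)).add
      (h3.mul ((hasBoundedMoments_coord_sum a).mul (hasBoundedMoments_coord_sum b))))
  exact (HasBoundedMoments.sum _ fun a => HasBoundedMoments.sum _ fun b =>
    (hT a b).mul (hT a b)).add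
    (HasBoundedMoments.sum _ fun a =>
      (hasBoundedMoments_coord_sum a).mul (hasBoundedMoments_coord_sum a))

lemma mul_gaussianDeviation_eq {J : ℕ} (hJ : 2 ≤ J) (x : Fin J → Fin n → ℝ) :
    J * gaussianDeviation (sampleMean (euclideanSample x)) (sampleCov (euclideanSample x)) =
      scaledDeviation J x := by
  have hJ' : (2 : ℝ) ≤ J := by exact_mod_cast hJ
  have hJ1 : (J : ℝ) - 1 ≠ 0 := by linarith
  have hJ0 : (0 : ℝ) < J := by linarith
  have hs : √(J : ℝ) ≠ 0 := (Real.sqrt_pos.mpr hJ0).ne'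
  have hss : √(J : ℝ) * √J = J := Real.mul_self_sqrt hJ0.le
  have hsi : (√(J : ℝ))⁻¹ * (√J)⁻¹ = (J : ℝ)⁻¹ := by rw [← mul_inv, hss]
  have hcoord : ∀ i a, euclideanSample x i a = x i a := fun _ _ => rfl
  rw [gaussianDeviation, scaledDeviation, mul_add, Finset.mul_sum, Finset.mul_sum]
  congr 1
  · refine Finset.sum_congr rfl fun a _ => ?_
    rw [Finset.mul_sum]
    refine Finset.sum_congr rfl fun b _ => ?_
    set δ := (1 : Matrix (Fin n) (Fin n) ℝ) a b
    -- The isolated term with `δ` comes from centring `J` products while dividing by `J - 1`.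
    have hkey : √J * (sampleCov (euclideanSample x) a b - δ) =
        ((J : ℝ) - 1)⁻¹ * J * ((√J)⁻¹ * ∑ i, (x i a * x i b - δ))
      + (((J : ℝ) - 1)⁻¹ * √J * δ
        + -(((J : ℝ) - 1)⁻¹ * √J) * (((√J)⁻¹ * ∑ i, x i a) * ((√J)⁻¹ * ∑ i, x i b))) := by
      rw [sampleCov_apply, sum_mul_sub_mean_mul_sub_mean _ (by omega)]
      simp only [hcoord]
      rw [Finset.sum_sub_distrib, Finset.sum_const, Finset.card_univ, Fintype.card_fin,
        nsmul_eq_mul, ← hsi]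
      have e1 : ((J : ℝ) - 1)⁻¹ * J * (√J)⁻¹ = ((J : ℝ) - 1)⁻¹ * √J := by
        calc ((J : ℝ) - 1)⁻¹ * J * (√J)⁻¹ = ((J : ℝ) - 1)⁻¹ * (√J * √J) * (√J)⁻¹ := by rw [hss]
          _ = _ := by field_simp
      rw [← mul_assoc, e1]
      field_simp
      ring
    rw [← hkey]
    linear_combination (-(sampleCov (euclideanSample x) a b - δ) ^ 2) * hss
  · refine Finset.sum_congr rfl fun a _ => ?_
    rw [sampleMean_apply, mul_mul_mul_comm, hsi]
    simp only [hcoord]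
    field_simp

end deviation

/-! ### Second moment of the weighted deviation. -/

section moment

variable {n : ℕ}

lemma ofReal_mul_gaussianDeviation_sq_le {J : ℕ} (hJ : 2 ≤ J) {s : ℝ} (hs : 0 < s)
    (x : Fin J → Fin n → ℝ) :
    ENNReal.ofReal ((1 + (((J : ℝ) - 1)⁻¹ * s)⁻¹) *
      gaussianDeviation (sampleMean (euclideanSample x)) (sampleCov (euclideanSample x))) ^ 2 ≤
    ((J : ℝ≥0∞)⁻¹) ^ 2 * (8 * (1 + (J : ℝ≥0∞) ^ 4 * ENNReal.ofReal s ^ (-4 : ℝ))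
      + ‖scaledDeviation J x‖ₑ ^ 4) := by
  have hJ' : (2 : ℝ) ≤ J := by exact_mod_cast hJ
  have hJ0 : (0 : ℝ) < J := by linarith
  set D := scaledDeviation J x with hD
  set g := gaussianDeviation (sampleMean (euclideanSample x)) (sampleCov (euclideanSample x))
    with hg
  have hgD : g = (J : ℝ)⁻¹ * D := by
    rw [hD, ← mul_gaussianDeviation_eq hJ, ← mul_assoc, inv_mul_cancel₀ hJ0.ne', one_mul]
  have hg0 : 0 ≤ g := gaussianDeviation_nonneg _ _
  set l := 1 + (((J : ℝ) - 1)⁻¹ * s)⁻¹ with hl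
  have hl0 : (((J : ℝ) - 1)⁻¹ * s)⁻¹ = (J - 1) * s⁻¹ := by rw [mul_inv, inv_inv]
  have hp : 0 ≤ ((J : ℝ) - 1) * s⁻¹ := mul_nonneg (by linarith) (by positivity)
  have hl1 : 0 ≤ l := by rw [hl, hl0]; linarith
  have hreal : (l * g) ^ 2 ≤ ((J : ℝ)⁻¹) ^ 2 * (8 * (1 + J ^ 4 * (s⁻¹) ^ 4) + |D| ^ 4) := by
    have h1 : (l * g) ^ 2 = ((J : ℝ)⁻¹) ^ 2 * (l ^ 2 * D ^ 2) := by rw [hgD]; ring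
    rw [h1]
    refine mul_le_mul_of_nonneg_left ?_ (by positivity)
    have h2 : l ≤ 1 + J * s⁻¹ := by
      rw [hl, hl0]
      have : ((J : ℝ) - 1) * s⁻¹ ≤ J * s⁻¹ :=
        mul_le_mul_of_nonneg_right (by linarith) (by positivity)
      linarith
    have h3 : l ^ 4 ≤ 8 * (1 + J ^ 4 * (s⁻¹) ^ 4) := by
      calc l ^ 4 ≤ (1 + J * s⁻¹) ^ 4 := pow_le_pow_left₀ hl1 h2 4
        _ ≤ 2 ^ (4 - 1) * (1 ^ 4 + (J * s⁻¹) ^ 4) :=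
          add_pow_le zero_le_one (by positivity) 4
        _ = _ := by ring
    have h4 : |D| ^ 4 = (D ^ 2) ^ 2 := by rw [← sq_abs D]; ring
    rw [h4]
    -- `l² D² ≤ l⁴ + D⁴` separates the weight from the deviation; this is why fourth inverse moments
    -- are required.
    nlinarith [sq_nonneg (l ^ 2 - D ^ 2), sq_nonneg (l ^ 2 + D ^ 2)]
  have hJE : (J : ℝ≥0∞) = ENNReal.ofReal J := (ENNReal.ofReal_natCast J).symm
  rw [← ENNReal.ofReal_pow (mul_nonneg hl1 hg0)]
  refine (ENNReal.ofReal_le_ofReal hreal).trans (le_of_eq ?_)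
  have hs4 : ENNReal.ofReal s ^ (-4 : ℝ) = ENNReal.ofReal ((s⁻¹) ^ 4) := by
    rw [ENNReal.ofReal_rpow_of_pos hs, Real.rpow_neg hs.le, inv_pow]
    norm_cast
  rw [ENNReal.ofReal_mul (by positivity), ENNReal.ofReal_pow (by positivity),
    ENNReal.ofReal_inv_of_pos hJ0, ENNReal.ofReal_add (by positivity) (by positivity),
    ENNReal.ofReal_mul (by positivity), ENNReal.ofReal_add (by positivity) (by positivity),
    ENNReal.ofReal_mul (by positivity), ENNReal.ofReal_pow hJ0.le,
    ENNReal.ofReal_pow (abs_nonneg D), hs4, hJE, Real.enorm_eq_ofReal_abs]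
  simp

/-- From some sample size on, the sample covariance of standard Gaussian vectors is almost surely
at least a positive random multiple `c` of the identity, and the second moment of the deviation
weighted by `1 + c⁻¹` is of order `J⁻²`. -/
theorem exists_sampleCov_lower_bound (n : ℕ) : ∃ C : ℝ≥0∞, C ≠ ∞ ∧ ∃ N : ℕ, ∀ J ≥ N,
    ∃ c : (Fin J → Fin n → ℝ) → ℝ,
      (∀ᵐ x ∂(Measure.pi fun _ : Fin J => stdGaussianPi (Fin n)), 0 < c x) ∧
      (∀ x v, c x * (v ⬝ᵥ v) ≤ v ⬝ᵥ (sampleCov (euclideanSample x)).mulVec v) ∧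
      ∫⁻ x, ENNReal.ofReal ((1 + (c x)⁻¹) *
        gaussianDeviation (sampleMean (euclideanSample x)) (sampleCov (euclideanSample x))) ^ 2
        ∂(Measure.pi fun _ : Fin J => stdGaussianPi (Fin n)) ≤ C * ((J : ℝ≥0∞)⁻¹) ^ 2 := by
  obtain ⟨B, hB, hDB⟩ := (hasBoundedMoments_scaledDeviation (n := n)).2 4
  have hDm := (hasBoundedMoments_scaledDeviation (n := n)).1
  -- A block uses `2n` vectors; the extra `1` keeps `m` positive when `n = 0`.
  set m := 2 * n + 1 with hm
  set Q := gramBoundMoment n ^ 32 with hQ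
  have hQt : Q ≠ ∞ := ENNReal.pow_ne_top (gramBoundMoment_ne_top n)
  refine ⟨8 * (1 + (2 * m : ℕ) ^ 4 * Q) + B, ?_, 32 * m, fun J hJ => ?_⟩
  · exact ENNReal.add_ne_top.mpr ⟨ENNReal.mul_ne_top (by simp) (ENNReal.add_ne_top.mpr
      ⟨by simp, ENNReal.mul_ne_top (by finiteness) hQt⟩), hB⟩
  set K := J / m with hK
  have hm0 : 0 < m := by omega
  have hK32 : 32 ≤ K := (Nat.le_div_iff_mul_le hm0).mpr hJ
  have hKm : K * m ≤ J := Nat.div_mul_le_self J m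
  -- It lets `J⁴` be absorbed by `K⁻⁴` at the cost of `(2m)⁴`.
  have hJK : J ≤ 2 * m * K := by
    have h1 : J < m * (K + 1) := Nat.lt_mul_div_succ J hm0
    nlinarith
  have hJ2 : 2 ≤ J := by omega
  have hJ' : (2 : ℝ) ≤ J := by exact_mod_cast hJ2
  obtain ⟨σ⟩ : Nonempty (Fin K × (Fin n ⊕ Fin n) ↪ Fin J) := by
    refine Function.Embedding.nonempty_of_card_le ?_
    simp only [Fintype.card_prod, Fintype.card_fin, Fintype.card_sum]
    calc K * (n + n) ≤ K * m := Nat.mul_le_mul_left K (by omega)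
      _ ≤ J := hKm
  have hint : ∫⁻ x, ENNReal.ofReal (blockGramBound σ x) ^ (-4 : ℝ)
      ∂(Measure.pi fun _ : Fin J => stdGaussianPi (Fin n)) ≤ (K : ℝ≥0∞) ^ (-4 : ℝ) * Q :=
    lintegral_sum_gramBound_rpow_neg_le hK32 σ.injective
  have hK0 : (K : ℝ≥0∞) ≠ 0 := by
    simp only [ne_eq, Nat.cast_eq_zero]; omega
  have hsm : Measurable fun x => ENNReal.ofReal (blockGramBound σ x) ^ (-4 : ℝ) :=
    (measurable_blockGramBound σ).ennreal_ofReal.pow_const _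
  -- A finite negative moment forces almost sure positivity, so no separate argument for
  -- invertibility is needed.
  have hpos : ∀ᵐ x ∂(Measure.pi fun _ : Fin J => stdGaussianPi (Fin n)),
      0 < blockGramBound σ x := by
    have hfin : ∫⁻ x, ENNReal.ofReal (blockGramBound σ x) ^ (-4 : ℝ)
        ∂(Measure.pi fun _ : Fin J => stdGaussianPi (Fin n)) ≠ ∞ := by
      refine ne_top_of_le_ne_top (ENNReal.mul_ne_top ?_ hQt) hint
      simp [ENNReal.rpow_eq_top_iff, hK0]
    filter_upwards [ae_lt_top hsm hfin] with x hx
    refine lt_of_le_of_ne (blockGramBound_nonneg _ _) fun h0 => ?_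
    rw [← h0, ENNReal.ofReal_zero, ENNReal.zero_rpow_of_neg (by norm_num)] at hx
    exact lt_irrefl _ hx
  refine ⟨fun x => ((J : ℝ) - 1)⁻¹ * blockGramBound σ x, ?_,
    fun x v => mul_dotProduct_le_sampleCov hJ2 σ.injective x v, ?_⟩
  · filter_upwards [hpos] with x hx
    exact mul_pos (inv_pos.mpr (by linarith)) hx
  have hD4 : Measurable fun x : Fin J → Fin n → ℝ => ‖scaledDeviation J x‖ₑ ^ 4 :=
    (hDm J).enorm.pow_const 4
  have h1 : Measurable fun x : Fin J → Fin n → ℝ =>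
      (J : ℝ≥0∞) ^ 4 * ENNReal.ofReal (blockGramBound σ x) ^ (-4 : ℝ) := hsm.const_mul _
  have h2 : Measurable fun x : Fin J → Fin n → ℝ =>
      1 + (J : ℝ≥0∞) ^ 4 * ENNReal.ofReal (blockGramBound σ x) ^ (-4 : ℝ) := h1.const_add 1
  have h3 : Measurable fun x : Fin J → Fin n → ℝ =>
      8 * (1 + (J : ℝ≥0∞) ^ 4 * ENNReal.ofReal (blockGramBound σ x) ^ (-4 : ℝ)) := h2.const_mul 8
  have h4 : Measurable fun x : Fin J → Fin n → ℝ =>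
      8 * (1 + (J : ℝ≥0∞) ^ 4 * ENNReal.ofReal (blockGramBound σ x) ^ (-4 : ℝ))
        + ‖scaledDeviation J x‖ₑ ^ 4 := h3.add hD4
  calc _ ≤ ∫⁻ x, ((J : ℝ≥0∞)⁻¹) ^ 2 * (8 * (1 + (J : ℝ≥0∞) ^ 4 *
          ENNReal.ofReal (blockGramBound σ x) ^ (-4 : ℝ)) + ‖scaledDeviation J x‖ₑ ^ 4)
          ∂(Measure.pi fun _ : Fin J => stdGaussianPi (Fin n)) := by
        refine lintegral_mono_ae ?_
        filter_upwards [hpos] with x hx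
        exact ofReal_mul_gaussianDeviation_sq_le hJ2 hx x
    _ = ((J : ℝ≥0∞)⁻¹) ^ 2 * (8 * (1 + (J : ℝ≥0∞) ^ 4 *
          ∫⁻ x, ENNReal.ofReal (blockGramBound σ x) ^ (-4 : ℝ)
            ∂(Measure.pi fun _ : Fin J => stdGaussianPi (Fin n))) +
          ∫⁻ x, ‖scaledDeviation J x‖ₑ ^ 4
            ∂(Measure.pi fun _ : Fin J => stdGaussianPi (Fin n))) := by
        rw [lintegral_const_mul _ h4, lintegral_add_left h3, lintegral_const_mul _ h2,
          lintegral_add_left measurable_const, lintegral_const_mul _ hsm, lintegral_const,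
          measure_univ, mul_one]
    _ ≤ ((J : ℝ≥0∞)⁻¹) ^ 2 * (8 * (1 + (2 * m : ℕ) ^ 4 * Q) + B) := by
        gcongr _ * (8 * (1 + ?_) + ?_)
        · calc (J : ℝ≥0∞) ^ 4 * _ ≤ ((2 * m * K : ℕ) : ℝ≥0∞) ^ 4 * ((K : ℝ≥0∞) ^ (-4 : ℝ) * Q) := by
                gcongr
            _ = ((2 * m : ℕ) : ℝ≥0∞) ^ 4 * ((K : ℝ≥0∞) ^ 4 * (K : ℝ≥0∞) ^ (-4 : ℝ)) * Q := by
                rw [Nat.cast_mul, mul_pow]; ring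
            _ = _ := by
                have e : (K : ℝ≥0∞) ^ 4 = (K : ℝ≥0∞) ^ (4 : ℝ) := by norm_cast
                rw [e, ← ENNReal.rpow_add _ _ hK0 (ENNReal.natCast_ne_top K)]
                simp
        · exact hDB J
    _ = _ := mul_comm _ _

end moment

/-! ### Reduction of a possibly singular covariance to the identity. -/

section reduction

/-- A positive semidefinite matrix is `A Aᵀ` for a matrix `A` with a left inverse. -/
lemma Matrix.PosSemidef.exists_factorization {d : ℕ} {C : Matrix (Fin d) (Fin d) ℝ}
    (hC : C.PosSemidef) :
    ∃ (r : ℕ) (A : Matrix (Fin d) (Fin r) ℝ) (B : Matrix (Fin r) (Fin d) ℝ),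
      A * A.transpose = C ∧ B * A = 1 := by
  set U : Matrix (Fin d) (Fin d) ℝ := hC.isHermitian.eigenvectorUnitary.1 with hU
  set l := hC.isHermitian.eigenvalues with hl
  have hl0 : ∀ i, 0 ≤ l i := hC.eigenvalues_nonneg
  have hUU : ∀ k k', ∑ i, U i k * U i k' = (1 : Matrix (Fin d) (Fin d) ℝ) k k' := fun k k' => by
    have h : star U * U = 1 := Unitary.coe_star_mul_self hC.isHermitian.eigenvectorUnitary
    rw [← h, Matrix.mul_apply]
    rfl
  have hCij : ∀ i j, C i j = ∑ k, U i k * l k * U j k := fun i j => by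
    have h := hC.isHermitian.spectral_theorem
    rw [Unitary.conjStarAlgAut_apply] at h
    conv_lhs => rw [h]
    rw [Matrix.mul_apply]
    refine Finset.sum_congr rfl fun k _ => ?_
    rw [Matrix.mul_diagonal]
    rfl
  -- Only eigenvectors with nonzero eigenvalue are kept. Scaling them by `√l` gives `A`, and by
  -- `(√l)⁻¹` the left inverse.
  set r := Fintype.card {i // l i ≠ 0}
  let e : Fin r ≃ {i // l i ≠ 0} := (Fintype.equivFin _).symm
  have hsp : ∀ k, 0 < √(l (e k)) := fun k =>
    Real.sqrt_pos.mpr (lt_of_le_of_ne (hl0 _) (e k).2.symm)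
  refine ⟨r, Matrix.of fun i k => U i (e k) * √(l (e k)),
    Matrix.of fun k i => (√(l (e k)))⁻¹ * U i (e k), ?_, ?_⟩
  · ext i j
    rw [Matrix.mul_apply, hCij]
    simp only [Matrix.transpose_apply, Matrix.of_apply]
    have h1 : ∀ k, U i (e k) * √(l (e k)) * (U j (e k) * √(l (e k))) =
        (fun p : {i // l i ≠ 0} => U i p * l p * U j p) (e k) := fun k => by
      have := Real.mul_self_sqrt (hl0 (e k))
      linear_combination (U i (e k) * U j (e k)) * this
    simp_rw [h1]
    rw [e.sum_comp (fun p : {i // l i ≠ 0} => U i p * l p * U j p),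
      ← Finset.sum_subtype (Finset.univ.filter fun k => l k ≠ 0) (by simp)
        (fun k => U i k * l k * U j k)]
    refine Finset.sum_filter_of_ne fun k _ hk h => hk ?_
    rw [h]
    ring
  · ext k k'
    rw [Matrix.mul_apply]
    simp only [Matrix.of_apply]
    have h1 : ∀ i, (√(l (e k)))⁻¹ * U i (e k) * (U i (e k') * √(l (e k'))) =
        (√(l (e k)))⁻¹ * √(l (e k')) * (U i (e k) * U i (e k')) := fun i => by ring
    simp_rw [h1]
    rw [← Finset.mul_sum, hUU]
    by_cases h : k = k'
    · subst h
      rw [Matrix.one_apply_eq, Matrix.one_apply_eq, inv_mul_cancel₀ (hsp k).ne', mul_one]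
    · rw [Matrix.one_apply_ne h, Matrix.one_apply_ne, mul_zero]
      exact fun h2 => h (e.injective (Subtype.ext h2))

variable {d r : ℕ}

/-- The affine map `y ↦ m + A y`. -/
def affineMap (m : EuclideanSpace ℝ (Fin d)) (A : Matrix (Fin d) (Fin r) ℝ)
    (y : EuclideanSpace ℝ (Fin r)) : EuclideanSpace ℝ (Fin d) :=
  m + WithLp.toLp 2 (A.mulVec y.ofLp)

@[fun_prop]
lemma measurable_affineMap (m : EuclideanSpace ℝ (Fin d)) (A : Matrix (Fin d) (Fin r) ℝ) :
    Measurable (affineMap m A) := by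
  have h : Continuous fun y : EuclideanSpace ℝ (Fin r) => A.mulVec y.ofLp :=
    Continuous.matrix_mulVec continuous_const (PiLp.continuous_ofLp 2 _)
  exact (((PiLp.continuous_toLp 2 _).comp h).const_add m).measurable

lemma affineMap_leftInverse (m : EuclideanSpace ℝ (Fin d)) {A : Matrix (Fin d) (Fin r) ℝ}
    {B : Matrix (Fin r) (Fin d) ℝ} (hBA : B * A = 1) :
    Function.LeftInverse (fun e => affineMap 0 B (e - m)) (affineMap m A) := fun y => by
  simp [affineMap, Matrix.mulVec_mulVec, hBA]

/-- `A` need not be square and the image may be singular, so characteristic functions are compared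
instead of densities. -/
lemma multivariateGaussian_affineMap (m : EuclideanSpace ℝ (Fin d)) (A : Matrix (Fin d) (Fin r) ℝ)
    (a : EuclideanSpace ℝ (Fin r)) {S : Matrix (Fin r) (Fin r) ℝ} (hS : S.PosSemidef) :
    multivariateGaussian (affineMap m A a) (A * S * A.transpose) =
      (multivariateGaussian a S).map (affineMap m A) := by
  have hS' : (A * S * A.transpose).PosSemidef := by
    rw [← Matrix.conjTranspose_eq_transpose_of_trivial]
    exact hS.mul_mul_conjTranspose_same A
  have : IsProbabilityMeasure ((multivariateGaussian a S).map (affineMap m A)) :=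
    Measure.isProbabilityMeasure_map (by fun_prop)
  refine Measure.ext_of_charFun (funext fun t => ?_)
  set t' : EuclideanSpace ℝ (Fin r) := WithLp.toLp 2 (A.transpose.mulVec t.ofLp) with ht'
  have hin : ∀ y : EuclideanSpace ℝ (Fin r),
      inner ℝ (affineMap m A y) t = inner ℝ m t + inner ℝ y t' := fun y => by
    rw [affineMap, inner_add_left]
    congr 1
    rw [EuclideanSpace.inner_eq_star_dotProduct, EuclideanSpace.inner_eq_star_dotProduct]
    simp only [star_trivial, ht']
    rw [Matrix.mulVec_transpose, ← Matrix.dotProduct_mulVec]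
  rw [charFun_multivariateGaussian hS', charFun_apply, integral_map (by fun_prop) (by fun_prop)]
  have hexp : ∀ y : EuclideanSpace ℝ (Fin r),
      Complex.exp ((inner ℝ (affineMap m A y) t : ℝ) * Complex.I) =
      Complex.exp ((inner ℝ m t : ℝ) * Complex.I) *
        Complex.exp ((inner ℝ y t' : ℝ) * Complex.I) := fun y => by
    rw [hin, ← Complex.exp_add]
    push_cast
    ring_nf
  simp_rw [hexp]
  rw [integral_const_mul, ← charFun_apply, charFun_multivariateGaussian hS, ← Complex.exp_add]
  congr 1
  have hq : t.ofLp ⬝ᵥ (A * S * A.transpose).mulVec t.ofLp = t'.ofLp ⬝ᵥ S.mulVec t'.ofLp := by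
    rw [ht', ← Matrix.mulVec_mulVec, ← Matrix.mulVec_mulVec, Matrix.dotProduct_mulVec,
      Matrix.mulVec_transpose, ← Matrix.mulVec_transpose]
  rw [hq, real_inner_comm, hin, real_inner_comm t' a, real_inner_comm t m]
  push_cast
  ring

lemma sampleMean_affineMap {J : ℕ} (hJ : J ≠ 0) (m : EuclideanSpace ℝ (Fin d))
    (A : Matrix (Fin d) (Fin r) ℝ) (y : Fin J → EuclideanSpace ℝ (Fin r)) :
    sampleMean (fun i => affineMap m A (y i)) = affineMap m A (sampleMean y) := by
  have hJ' : (J : ℝ) ≠ 0 := by exact_mod_cast hJ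
  ext a
  rw [sampleMean_apply]
  simp only [affineMap, PiLp.add_apply, Matrix.mulVec, dotProduct, sampleMean_apply]
  rw [Finset.sum_add_distrib, Finset.sum_const, Finset.card_univ, Fintype.card_fin, nsmul_eq_mul,
    mul_add, inv_mul_cancel_left₀ hJ', Finset.sum_comm]
  congr 1
  rw [Finset.mul_sum]
  refine Finset.sum_congr rfl fun b _ => ?_
  rw [← Finset.mul_sum]
  ring

lemma sampleCov_affineMap {J : ℕ} (hJ : J ≠ 0) (m : EuclideanSpace ℝ (Fin d))
    (A : Matrix (Fin d) (Fin r) ℝ) (y : Fin J → EuclideanSpace ℝ (Fin r)) :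
    sampleCov (fun i => affineMap m A (y i)) = A * sampleCov y * A.transpose := by
  have h : ∀ i, affineMap m A (y i) - sampleMean (fun i => affineMap m A (y i)) =
      WithLp.toLp 2 (A.mulVec (y i - sampleMean y).ofLp) := fun i => by
    rw [sampleMean_affineMap hJ]
    simp [affineMap, Matrix.mulVec_sub]
  simp only [sampleCov, h]
  rw [Matrix.mul_smul, Matrix.smul_mul, Matrix.mul_sum, Matrix.sum_mul]
  congr 1
  refine Finset.sum_congr rfl fun i _ => ?_
  rw [Matrix.mul_vecMulVec, Matrix.vecMulVec_mul, Matrix.vecMul_transpose]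

end reduction

/-! ### Measurability of the closed forms in the sample. -/

section measurability

variable {J n : ℕ}

lemma continuous_sampleMean_euclideanSample (a : Fin n) :
    Continuous fun x : Fin J → Fin n → ℝ => sampleMean (euclideanSample x) a := by
  simp only [sampleMean_apply, euclideanSample]
  fun_prop

lemma continuous_sampleCov_euclideanSample :
    Continuous fun x : Fin J → Fin n → ℝ => sampleCov (euclideanSample x) := by
  refine continuous_matrix fun a b => ?_
  have hM := continuous_sampleMean_euclideanSample (J := J) (n := n)
  have hx : ∀ i a, Continuous fun x : Fin J → Fin n → ℝ => euclideanSample x i a := fun i a => by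
    simp only [euclideanSample]
    fun_prop
  simp only [sampleCov_apply]
  exact continuous_const.mul (continuous_finsetSum _ fun i _ =>
    ((hx i a).sub (hM a)).mul ((hx i b).sub (hM b)))

lemma measurable_log_det_sampleCov :
    Measurable fun x : Fin J → Fin n → ℝ => Real.log (sampleCov (euclideanSample x)).det :=
  Real.measurable_log.comp continuous_sampleCov_euclideanSample.matrix_det.measurable

lemma measurable_inv_sampleCov (a b : Fin n) :
    Measurable fun x : Fin J → Fin n → ℝ => (sampleCov (euclideanSample x))⁻¹ a b := by
  simp only [Matrix.inv_def, Ring.inverse_eq_inv', Matrix.smul_apply, smul_eq_mul]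
  exact continuous_sampleCov_euclideanSample.matrix_det.measurable.inv.mul
    (continuous_sampleCov_euclideanSample.matrix_adjugate.matrix_elem a b).measurable

lemma measurable_klDiv_stdGaussian_sample_formula :
    Measurable fun x : Fin J → Fin n → ℝ =>
      ENNReal.ofReal (((sampleCov (euclideanSample x))⁻¹.trace +
        (sampleMean (euclideanSample x)).ofLp ⬝ᵥ
          (sampleCov (euclideanSample x))⁻¹.mulVec (sampleMean (euclideanSample x)).ofLp -
        Fintype.card (Fin n) + Real.log (sampleCov (euclideanSample x)).det) / 2) := by
  have hM := fun a : Fin n => (continuous_sampleMean_euclideanSample (J := J) a).measurable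
  have hI := fun a b : Fin n => measurable_inv_sampleCov (J := J) a b
  have h1 : Measurable fun x : Fin J → Fin n → ℝ => (sampleCov (euclideanSample x))⁻¹.trace :=
    Finset.measurable_sum _ fun a _ => hI a a
  have h2 : Measurable fun x : Fin J → Fin n → ℝ => (sampleMean (euclideanSample x)).ofLp ⬝ᵥ
      (sampleCov (euclideanSample x))⁻¹.mulVec (sampleMean (euclideanSample x)).ofLp := by
    simp only [dotProduct, Matrix.mulVec]
    exact Finset.measurable_sum _ fun a _ => (hM a).mul
      (Finset.measurable_fun_sum _ fun b _ => (hI a b).mul (hM b))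
  exact ((((h1.add h2).sub_const _).add measurable_log_det_sampleCov).div_const 2).ennreal_ofReal

lemma measurable_klDiv_sample_stdGaussian_formula :
    Measurable fun x : Fin J → Fin n → ℝ =>
      ENNReal.ofReal (((sampleCov (euclideanSample x)).trace +
        (sampleMean (euclideanSample x)).ofLp ⬝ᵥ (sampleMean (euclideanSample x)).ofLp -
        Fintype.card (Fin n) - Real.log (sampleCov (euclideanSample x)).det) / 2) := by
  have hM := fun a : Fin n => (continuous_sampleMean_euclideanSample (J := J) a).measurable
  have h1 : Measurable fun x : Fin J → Fin n → ℝ => (sampleCov (euclideanSample x)).trace :=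
    continuous_sampleCov_euclideanSample.matrix_trace.measurable
  have h2 : Measurable fun x : Fin J → Fin n → ℝ => (sampleMean (euclideanSample x)).ofLp ⬝ᵥ
      (sampleMean (euclideanSample x)).ofLp :=
    Finset.measurable_sum _ fun a _ => (hM a).mul (hM a)
  exact ((((h1.add h2).sub_const _).sub measurable_log_det_sampleCov).div_const 2).ennreal_ofReal

end measurability

/-! ### Transfer between the given samples and standard ones. -/

section transfer

variable {d r : ℕ} {m : EuclideanSpace ℝ (Fin d)} {A : Matrix (Fin d) (Fin r) ℝ}
  {B : Matrix (Fin r) (Fin d) ℝ}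

lemma multivariateGaussian_mul_transpose (m : EuclideanSpace ℝ (Fin d))
    (A : Matrix (Fin d) (Fin r) ℝ) :
    multivariateGaussian m (A * A.transpose) =
      (stdGaussian (EuclideanSpace ℝ (Fin r))).map (affineMap m A) := by
  have h := multivariateGaussian_affineMap m A 0 Matrix.PosSemidef.one
  rw [multivariateGaussian_zero_one, Matrix.mul_one] at h
  rw [← h]
  simp [affineMap]

lemma multivariateGaussian_sample_affineMap {J : ℕ} (hJ : J ≠ 0)
    (y : Fin J → EuclideanSpace ℝ (Fin r)) (hS : (sampleCov y).PosSemidef) :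
    multivariateGaussian (sampleMean fun i => affineMap m A (y i))
        (sampleCov fun i => affineMap m A (y i)) =
      (multivariateGaussian (sampleMean y) (sampleCov y)).map (affineMap m A) := by
  rw [sampleMean_affineMap hJ, sampleCov_affineMap hJ, multivariateGaussian_affineMap m A _ hS]

/-- The law of a Gaussian sample is the image of the law of a standard Gaussian sample. -/
lemma pi_multivariateGaussian_eq_map (m : EuclideanSpace ℝ (Fin d)) (A : Matrix (Fin d) (Fin r) ℝ)
    (J : ℕ) :
    Measure.pi (fun _ : Fin J => multivariateGaussian m (A * A.transpose)) =
      (Measure.pi fun _ : Fin J => stdGaussianPi (Fin r)).map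
        fun x i => affineMap m A (euclideanSample x i) := by
  have hT : Measurable fun y : Fin r → ℝ => affineMap m A (WithLp.toLp 2 y) := by fun_prop
  have h : multivariateGaussian m (A * A.transpose) =
      (stdGaussianPi (Fin r)).map fun y => affineMap m A (WithLp.toLp 2 y) := by
    rw [multivariateGaussian_mul_transpose, ← map_pi_eq_stdGaussian,
      Measure.map_map (by fun_prop) (by fun_prop)]
    rfl
  have : IsProbabilityMeasure
      ((stdGaussianPi (Fin r)).map fun y => affineMap m A (WithLp.toLp 2 y)) :=
    Measure.isProbabilityMeasure_map hT.aemeasurable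
  rw [h]
  exact (Measure.pi_map_pi fun _ => hT.aemeasurable).symm

lemma measurableEmbedding_affineMap_euclideanSample (m : EuclideanSpace ℝ (Fin d))
    (hBA : B * A = 1) (J : ℕ) :
    MeasurableEmbedding fun (x : Fin J → Fin r → ℝ) i => affineMap m A (euclideanSample x i) := by
  refine Measurable.measurableEmbedding ?_ fun x y h => funext fun i => ?_
  · unfold euclideanSample
    fun_prop
  · exact WithLp.toLp_injective 2 ((affineMap_leftInverse m hBA).injective (congrFun h i))

/-- Measurability of `F J` is required only along affine images of standard samples. Since `A` is
injective, that parametrization is a measurable embedding, and almost everywhere measurability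
passes to the law of the sample. -/
lemma convergesToZeroInL2WithRate_of_lintegral_sq_le (hBA : B * A = 1)
    {Ω : ℕ → Type*} [∀ J, MeasurableSpace (Ω J)] (P : ∀ J, Measure (Ω J))
    [∀ J, IsProbabilityMeasure (P J)] (X : ∀ J, Fin J → Ω J → EuclideanSpace ℝ (Fin d))
    (hlaw : ∀ J i, HasLaw (X J i) (multivariateGaussian m (A * A.transpose)) (P J))
    (hindep : ∀ J, iIndepFun (X J) (P J))
    (F : ∀ J, (Fin J → EuclideanSpace ℝ (Fin d)) → ℝ≥0∞) {K : ℝ≥0∞} (hK : K ≠ ∞) (N : ℕ)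
    (hF : ∀ J ≥ N, AEStronglyMeasurable
      (fun x : Fin J → Fin r → ℝ => F J fun i => affineMap m A (euclideanSample x i))
      (Measure.pi fun _ => stdGaussianPi (Fin r)))
    (hint : ∀ J ≥ N, ∫⁻ x : Fin J → Fin r → ℝ,
      F J (fun i => affineMap m A (euclideanSample x i)) ^ 2
        ∂(Measure.pi fun _ => stdGaussianPi (Fin r)) ≤ K * ((J : ℝ≥0∞)⁻¹) ^ 2) :
    ConvergesToZeroInL2WithRate P (fun J ω => F J fun i => X J i ω) fun J => (J : ℝ)⁻¹ := by
  have hX : ∀ J, HasLaw (fun ω i => X J i ω)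
      (Measure.pi fun _ : Fin J => multivariateGaussian m (A * A.transpose)) (P J) :=
    fun J => iIndepFun.hasLaw_pi (hlaw J) (hindep J)
  have hmeas : ∀ J ≥ N, AEStronglyMeasurable (F J) ((P J).map fun ω i => X J i ω) := by
    intro J hJ
    rw [(hX J).map_eq, pi_multivariateGaussian_eq_map]
    exact (measurableEmbedding_affineMap_euclideanSample m hBA J).aestronglyMeasurable_map_iff.mpr
      (hF J hJ)
  have hnorm : ∀ J ≥ N, eLpNorm (fun ω => F J fun i => X J i ω) 2 (P J) ≤
      K ^ (1 / 2 : ℝ) * (J : ℝ≥0∞)⁻¹ := by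
    intro J hJ
    have h1 : eLpNorm (fun ω => F J fun i => X J i ω) 2 (P J) =
        eLpNorm (fun x : Fin J → Fin r → ℝ => F J fun i => affineMap m A (euclideanSample x i)) 2
          (Measure.pi fun _ => stdGaussianPi (Fin r)) := by
      have h2 := eLpNorm_map_measure (p := 2) (hmeas J hJ) (hX J).aemeasurable
      rw [(hX J).map_eq, pi_multivariateGaussian_eq_map,
        (measurableEmbedding_affineMap_euclideanSample m hBA J).eLpNorm_map_measure] at h2
      exact h2.symm
    rw [h1, eLpNorm_eq_lintegral_rpow_enorm_toReal (by norm_num) (by norm_num)]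
    simp only [enorm_eq_self, ENNReal.toReal_ofNat, ENNReal.rpow_ofNat]
    calc _ ≤ (K * ((J : ℝ≥0∞)⁻¹) ^ 2) ^ (1 / 2 : ℝ) :=
          ENNReal.rpow_le_rpow (hint J hJ) (by norm_num)
      _ = _ := by
          rw [ENNReal.mul_rpow_of_nonneg _ _ (by norm_num), ← ENNReal.rpow_natCast,
            ← ENNReal.rpow_mul]
          norm_num
  have hK' : K ^ (1 / 2 : ℝ) ≠ ∞ := ENNReal.rpow_ne_top_of_nonneg (by norm_num) hK
  refine ⟨?_, ?_, ?_⟩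
  · filter_upwards [eventually_ge_atTop N, eventually_ne_atTop 0] with J hJ hJ0
    refine ⟨(hmeas J hJ).comp_aemeasurable (hX J).aemeasurable, (hnorm J hJ).trans_lt ?_⟩
    exact ENNReal.mul_lt_top hK'.lt_top (by simpa [pos_iff_ne_zero] using hJ0)
  · refine tendsto_of_tendsto_of_tendsto_of_le_of_le' tendsto_const_nhds
      (h := fun J : ℕ => K ^ (1 / 2 : ℝ) * (J : ℝ≥0∞)⁻¹) ?_ (Eventually.of_forall fun _ => zero_le)
      ((eventually_ge_atTop N).mono hnorm)
    have h := ENNReal.Tendsto.const_mul (a := K ^ (1 / 2 : ℝ)) ENNReal.tendsto_inv_nat_nhds_zero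
      (Or.inr hK')
    rwa [mul_zero] at h
  · refine IsBigO.of_bound (K ^ (1 / 2 : ℝ)).toReal ?_
    filter_upwards [eventually_ge_atTop N, eventually_ne_atTop 0] with J hJ hJ0
    rw [Real.norm_of_nonneg ENNReal.toReal_nonneg, Real.norm_of_nonneg (by positivity)]
    have h := ENNReal.toReal_mono (ENNReal.mul_ne_top hK' (by simpa using hJ0)) (hnorm J hJ)
    rwa [ENNReal.toReal_mul, ENNReal.toReal_inv, ENNReal.toReal_natCast] at h

end transfer

/-! ### The two divergences. -/

theorem mainTheorem3 {d : ℕ} (m : EuclideanSpace ℝ (Fin d)) (C : Matrix (Fin d) (Fin d) ℝ)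
    (hC : C.PosSemidef)
    {Ω : ℕ → Type*} [∀ J, MeasurableSpace (Ω J)]
    (P : ∀ J, Measure (Ω J)) [∀ J, IsProbabilityMeasure (P J)]
    (X : ∀ J, Fin J → Ω J → EuclideanSpace ℝ (Fin d))
    (hlaw : ∀ J i, HasLaw (X J i) (multivariateGaussian m C) (P J))
    (hindep : ∀ J, iIndepFun (X J) (P J)) :
    ConvergesToZeroInL2WithRate P
      (fun J ω => klDiv (multivariateGaussian m C)
        (multivariateGaussian (sampleMean fun i => X J i ω) (sampleCov fun i => X J i ω)))
      (fun J => (J : ℝ)⁻¹) ∧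
    ConvergesToZeroInL2WithRate P
      (fun J ω => klDiv
        (multivariateGaussian (sampleMean fun i => X J i ω) (sampleCov fun i => X J i ω))
        (multivariateGaussian m C))
      (fun J => (J : ℝ)⁻¹) := by
  obtain ⟨r, A, B, rfl, hBA⟩ := hC.exists_factorization
  obtain ⟨K, hK, N, hN⟩ := exists_sampleCov_lower_bound r
  have hT := measurable_affineMap m A
  have hR : Measurable fun e => affineMap 0 B (e - m) := by fun_prop
  have hl := affineMap_leftInverse m hBA
  have hpos : ∀ J ≥ N, ∀ᵐ x ∂(Measure.pi fun _ : Fin J => stdGaussianPi (Fin r)),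
      (sampleCov (euclideanSample x)).PosDef := by
    intro J hJ
    obtain ⟨c, hc, hcS, -⟩ := hN J hJ
    filter_upwards [hc] with x hx
    exact posDef_of_mul_dotProduct_le (sampleCov_transpose _) hx (hcS x)
  constructor
  · have heq : ∀ J ≠ 0, ∀ x : Fin J → Fin r → ℝ, (sampleCov (euclideanSample x)).PosDef →
        klDiv (multivariateGaussian m (A * A.transpose))
          (multivariateGaussian (sampleMean fun i => affineMap m A (euclideanSample x i))
            (sampleCov fun i => affineMap m A (euclideanSample x i))) =
        klDiv (stdGaussian (EuclideanSpace ℝ (Fin r))) (multivariateGaussian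
          (sampleMean (euclideanSample x)) (sampleCov (euclideanSample x))) := by
      intro J hJ x hS
      rw [multivariateGaussian_sample_affineMap hJ _ hS.posSemidef,
        multivariateGaussian_mul_transpose, klDiv_map_of_leftInverse _ _ hT hR hl]
    -- The threshold `N + 1` excludes `J = 0`, where the sample mean is `0` and does not follow the
    -- affine map.
    refine convergesToZeroInL2WithRate_of_lintegral_sq_le hBA P X hlaw hindep
      (fun J x => klDiv (multivariateGaussian m (A * A.transpose))
        (multivariateGaussian (sampleMean x) (sampleCov x))) hK (N + 1) (fun J hJ => ?_)
      fun J hJ => ?_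
    -- The divergence agrees with a measurable formula wherever the sample covariance is positive
    -- definite, which is almost everywhere.
    · refine measurable_klDiv_stdGaussian_sample_formula.aestronglyMeasurable.congr ?_
      filter_upwards [hpos J (by omega)] with x hx
      rw [heq J (by omega) x hx, klDiv_stdGaussian_multivariateGaussian _ hx]
    · obtain ⟨c, hc, hcS, hint⟩ := hN J (by omega)
      refine (lintegral_mono_ae ?_).trans hint
      filter_upwards [hc, hpos J (by omega)] with x hx hS
      rw [heq J (by omega) x hS]
      gcongr
      exact klDiv_stdGaussian_multivariateGaussian_le _ hS hx (hcS x)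
  · have heq : ∀ J ≠ 0, ∀ x : Fin J → Fin r → ℝ, (sampleCov (euclideanSample x)).PosDef →
        klDiv (multivariateGaussian (sampleMean fun i => affineMap m A (euclideanSample x i))
            (sampleCov fun i => affineMap m A (euclideanSample x i)))
          (multivariateGaussian m (A * A.transpose)) =
        klDiv (multivariateGaussian (sampleMean (euclideanSample x))
          (sampleCov (euclideanSample x))) (stdGaussian (EuclideanSpace ℝ (Fin r))) := by
      intro J hJ x hS
      rw [multivariateGaussian_sample_affineMap hJ _ hS.posSemidef,
        multivariateGaussian_mul_transpose, klDiv_map_of_leftInverse _ _ hT hR hl]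
    refine convergesToZeroInL2WithRate_of_lintegral_sq_le hBA P X hlaw hindep
      (fun J x => klDiv (multivariateGaussian (sampleMean x) (sampleCov x))
        (multivariateGaussian m (A * A.transpose))) hK (N + 1) (fun J hJ => ?_)
      fun J hJ => ?_
    · refine measurable_klDiv_sample_stdGaussian_formula.aestronglyMeasurable.congr ?_
      filter_upwards [hpos J (by omega)] with x hx
      rw [heq J (by omega) x hx, klDiv_multivariateGaussian_stdGaussian _ hx]
    · obtain ⟨c, hc, hcS, hint⟩ := hN J (by omega)
      refine (lintegral_mono_ae ?_).trans hint
      filter_upwards [hc, hpos J (by omega)] with x hx hS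
      rw [heq J (by omega) x hS]
      gcongr
      exact klDiv_multivariateGaussian_stdGaussian_le _ hS hx (hcS x)
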